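/- Let $p\in(0,\infty)$ be a non-integer, let $\ell:=\lceil p-1\rceil$ be the smallest integer that is no less than $p-1$ (so $\ell\ge 0$ and $\ell<p<\ell+1$), and for complex $z$ let $$e_\ell(z):=e^z-\sum_{j=0}^{\ell}\frac{z^j}{j!}.$$ For real $x$ write $x_+:=\max(x,0)$ and $x_-:=(-x)_+$, with $|x|^0:=1$. Let $X$ be any real-valued random variable with $\mathsf E X_+^p<\infty$. Then the following two conditions are equivalent to each other: (I) $\mathsf E|X|^\ell<\infty$ and $$\mathsf E X_+^p=\frac{\Gamma(p+1)}{\pi}\int_{0+}^\infty \operatorname{Re}\frac{\mathsf E\, e_\ell(itX)}{(it)^{p+1}}\,dt ,$$ where $(it)^{p+1}$ is the principal value of the power and the integral is improper at $0$, that is, the integrand is Lebesgue integrable on $(v,\infty)$ for each $v>0$, and $\int_{0+}^\infty$ is the (existing, finite) limit of $\int_v^\infty$ as $v\downarrow0$; (II) $\mathsf P(X_->x)=o(1/x^p)$ as $x\to\infty$. -/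

import Mathlib

open MeasureTheory Filter Topology Asymptotics

/-- The exponential remainder `e_m(z) = exp z - ∑_{j=0}^m z^j / j!`, for `m = 0, 1, …`. -/
noncomputable def expRemainder (m : ℕ) (z : ℂ) : ℂ :=
  Complex.exp z - ∑ j ∈ Finset.range (m + 1), z ^ j / (j.factorial : ℂ)

/-- `ℓ(p)`, the smallest integer that is no less than `p - 1`. For `p > 0` this integer is
nonnegative, so that the `ℕ`-valued ceiling is the usual one. -/
noncomputable def ell (p : ℝ) : ℕ := ⌈p - 1⌉₊

/-- `∫_{0+}^∞ f(t) dt = L`, the integral being improper at `0`: the function `f` is Lebesgue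
integrable on `(v, ∞)` for each `v > 0`, and `∫_v^∞ f(t) dt → L` as `v ↓ 0`. -/
def HasImproperIntegralAtZero (f : ℝ → ℝ) (L : ℝ) : Prop :=
  (∀ v : ℝ, 0 < v → IntegrableOn f (Set.Ioi v)) ∧
    Tendsto (fun v : ℝ => ∫ t in Set.Ioi v, f t) (𝓝[>] 0) (𝓝 L)

/-- The function `t ↦ Re (E e_ℓ(i t X) / (i t)^(p+1))`, `ℓ = ℓ(p)`, with the principal branch
of the power. -/
noncomputable def momentIntegrand {Ω : Type*} [MeasurableSpace Ω] (P : Measure Ω)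
    (X : Ω → ℝ) (p : ℝ) (t : ℝ) : ℝ :=
  ((∫ ω, expRemainder (ell p) (Complex.I * (t : ℂ) * (X ω : ℂ)) ∂P) /
    (Complex.I * (t : ℂ)) ^ ((p : ℂ) + 1)).re

/-! Write m = ℓ and Y = X_-. By Fubini and the scaling t = v s, the integral over (v, ∞) equals
v^(-p) E T(vX) with T = `kernelTail m p`. Since T(0) = 0, this splits into a contribution of X_+ and
one of Y. The bound |T(a)| ≤ D a^p for a ≥ 0 and dominated convergence send the first to π/Γ(p+1) ·
E X_+^p. So, given E|X|^m < ∞, the formula in (I) says exactly that v^(-p) E T(-vY) → 0, and it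
remains to match this with the tail condition on Y.

From tails to the limit: the full integral of the kernel over the negative ray vanishes
(`integral_remainderKernel_neg`), so T(-a) is minus an integral over (0, a], which gives |T(-a)| ≤ C
min(a^m, a^(m+1)). As m < p < m+1, the layer-cake formula and dominated convergence apply
(`tendsto_rpow_neg_mul_integral_kernelTail_neg`).

From the limit to tails: no sign of T is available, so T is averaged over scales against e^(-s). The
average has a rational kernel; on the negative ray this kernel changes sign once and has total
integral 0, so its tail integrals have constant sign and stay away from 0 at infinity. Averaging
preserves the limit 0 (`tendsto_rpow_neg_mul_integral_averagedTail`), and Markov's inequality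
recovers the tail of Y (`tendsto_rpow_mul_tail`).

The same averaging evaluates the full integrals on both rays, by reduction to ∫ u^r/(1+u²) du. -/

/-! ### Exponential remainders on the imaginary axis. -/

theorem hasDerivAt_expRemainder_succ (m : ℕ) (z : ℂ) :
    HasDerivAt (expRemainder (m + 1)) (expRemainder m z) z := by
  have h : ∀ n : ℕ, HasDerivAt (fun z : ℂ => ∑ j ∈ Finset.range (n + 1), z ^ j / (j.factorial : ℂ))
      (∑ j ∈ Finset.range n, z ^ j / (j.factorial : ℂ)) z := by
    intro n
    induction n with
    | zero => simpa using hasDerivAt_const z (1 : ℂ)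
    | succ n ih =>
      simp_rw [Finset.sum_range_succ _ (n + 1)]
      rw [Finset.sum_range_succ]
      refine ih.add ?_
      convert! (hasDerivAt_pow (n + 1) z).div_const _ using 1
      rw [Nat.factorial_succ]
      have : (n.factorial : ℂ) ≠ 0 := by exact_mod_cast n.factorial_ne_zero
      have h2 : ((n : ℂ) + 1) ≠ 0 := by exact_mod_cast n.succ_ne_zero
      push_cast
      field_simp
  exact (Complex.hasDerivAt_exp z).sub (h (m + 1))

theorem expRemainder_apply_zero (m : ℕ) : expRemainder m 0 = 0 := by
  simp [expRemainder, Finset.sum_range_succ']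

theorem continuous_expRemainder (m : ℕ) : Continuous (expRemainder m) := by
  unfold expRemainder
  fun_prop

/-- Induction by the mean value inequality between 0 and u, since e_(m+1)' = e_m; the factorial gain
is not needed. This bound is the sharp order near 0, the next one the order at infinity. -/
theorem norm_expRemainder_I_mul_le_pow_succ (m : ℕ) (u : ℝ) :
    ‖expRemainder m (Complex.I * u)‖ ≤ |u| ^ (m + 1) := by
  induction m generalizing u with
  | zero =>
    simpa [expRemainder] using Real.norm_exp_I_mul_ofReal_sub_one_le (x := u)
  | succ m ih =>
    have hd : ∀ x : ℝ, HasDerivAt (fun y : ℝ => expRemainder (m + 1) (Complex.I * y))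
        (expRemainder m (Complex.I * x) * Complex.I) x := by
      intro x
      have h1 : HasDerivAt (fun y : ℝ => Complex.I * (y : ℂ)) Complex.I x := by
        simpa using (Complex.ofRealCLM.hasDerivAt (x := x)).const_mul Complex.I
      exact (hasDerivAt_expRemainder_succ m _).comp x h1
    have := (convex_uIcc (0 : ℝ) u).norm_image_sub_le_of_norm_hasDerivWithin_le
      (f := fun y : ℝ => expRemainder (m + 1) (Complex.I * y)) (C := |u| ^ (m + 1))
      (fun x _ => (hd x).hasDerivWithinAt) (fun x hx => by
        rw [norm_mul, Complex.norm_I, mul_one]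
        refine (ih x).trans ?_
        have := Set.abs_sub_left_of_mem_uIcc hx
        simp only [sub_zero] at this
        gcongr) Set.left_mem_uIcc Set.right_mem_uIcc
    simpa [expRemainder_apply_zero, pow_succ] using this

theorem norm_expRemainder_I_mul_le_pow (m : ℕ) (u : ℝ) :
    ‖expRemainder m (Complex.I * u)‖ ≤ 2 * |u| ^ m := by
  cases m with
  | zero =>
    have h : ‖Complex.exp (Complex.I * u)‖ = 1 := by
      rw [mul_comm]; exact Complex.norm_exp_ofReal_mul_I u
    have := norm_sub_le (Complex.exp (Complex.I * u)) 1
    simp only [h, norm_one] at this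
    simp only [expRemainder, Finset.sum_range_succ, Finset.sum_range_zero]
    simp
    linarith
  | succ m =>
    have h1 : expRemainder (m + 1) (Complex.I * u) =
        expRemainder m (Complex.I * u) - (Complex.I * u) ^ (m + 1) / ((m + 1).factorial : ℂ) := by
      simp only [expRemainder, Finset.sum_range_succ _ (m + 1)]
      ring
    have h2 : ‖(Complex.I * (u : ℂ)) ^ (m + 1) / ((m + 1).factorial : ℂ)‖ ≤ |u| ^ (m + 1) := by
      rw [norm_div, norm_pow, norm_mul, Complex.norm_I, one_mul, Complex.norm_real,
        Real.norm_eq_abs, Complex.norm_natCast]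
      refine div_le_self (by positivity) ?_
      exact_mod_cast Nat.one_le_iff_ne_zero.mpr (Nat.factorial_ne_zero _)
    rw [h1]
    linarith [norm_sub_le (expRemainder m (Complex.I * u))
      ((Complex.I * (u : ℂ)) ^ (m + 1) / ((m + 1).factorial : ℂ)),
      norm_expRemainder_I_mul_le_pow_succ m u]

/-! ### The real kernel and its two-regime bound. -/

/-- The kernel `u ↦ Re (e_m(i u) / i^(p+1))`. -/
noncomputable def remainderKernel (m : ℕ) (p u : ℝ) : ℝ :=
  (expRemainder m (Complex.I * u) / Complex.I ^ ((p : ℂ) + 1)).re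

/-- The function `a ↦ min (a^m) (a^(m+1))`. -/
noncomputable def minPow (m : ℕ) (a : ℝ) : ℝ := min (a ^ m) (a ^ (m + 1))

theorem I_cpow_ofReal_add_one (p : ℝ) :
    Complex.I ^ ((p : ℂ) + 1) = Complex.exp (((Real.pi / 2 * (p + 1) : ℝ) : ℂ) * Complex.I) := by
  rw [Complex.cpow_def_of_ne_zero Complex.I_ne_zero, Complex.log_I]
  congr 1
  push_cast
  ring

theorem norm_I_cpow_ofReal_add_one (p : ℝ) : ‖Complex.I ^ ((p : ℂ) + 1)‖ = 1 := by
  rw [I_cpow_ofReal_add_one, Complex.norm_exp_ofReal_mul_I]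

theorem continuous_remainderKernel (m : ℕ) (p : ℝ) : Continuous (remainderKernel m p) := by
  unfold remainderKernel
  have := continuous_expRemainder m
  fun_prop

theorem remainderKernel_zero (m : ℕ) (p : ℝ) : remainderKernel m p 0 = 0 := by
  simp [remainderKernel, expRemainder_apply_zero]

theorem continuous_minPow (m : ℕ) : Continuous (minPow m) := by
  unfold minPow; fun_prop

theorem minPow_nonneg (m : ℕ) {a : ℝ} (ha : 0 ≤ a) : 0 ≤ minPow m a := by
  unfold minPow; positivity

theorem minPow_le_pow (m : ℕ) (a : ℝ) : minPow m a ≤ a ^ m := min_le_left _ _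

theorem minPow_le_pow_succ (m : ℕ) (a : ℝ) : minPow m a ≤ a ^ (m + 1) := min_le_right _ _

theorem minPow_eq (m : ℕ) {a : ℝ} (ha : 0 ≤ a) : minPow m a = a ^ m * min 1 a := by
  rw [minPow, pow_succ, mul_min_of_nonneg _ _ (pow_nonneg ha m), mul_one]

/-- Pulls a scale factor out at polynomial cost, which e^(-s) absorbs in the Fubini arguments. -/
theorem minPow_mul_le (m : ℕ) {a b : ℝ} (ha : 0 ≤ a) (hb : 0 ≤ b) :
    minPow m (a * b) ≤ (a ^ m + a ^ (m + 1)) * minPow m b := by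
  rw [minPow_eq m (mul_nonneg ha hb), minPow_eq m hb]
  have : min 1 (a * b) ≤ (1 + a) * min 1 b := by
    rcases le_total 1 b with h | h
    · rw [min_eq_left h]; linarith [min_le_left 1 (a * b)]
    · rw [min_eq_right h]; nlinarith [min_le_right 1 (a * b)]
  calc (a * b) ^ m * min 1 (a * b) ≤ (a * b) ^ m * ((1 + a) * min 1 b) := by gcongr
    _ = _ := by ring

theorem abs_remainderKernel_le (m : ℕ) (p u : ℝ) :
    |remainderKernel m p u| ≤ 2 * minPow m |u| := by
  have h : |remainderKernel m p u| ≤ ‖expRemainder m (Complex.I * u)‖ := by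
    refine (Complex.abs_re_le_norm _).trans ?_
    rw [norm_div, norm_I_cpow_ofReal_add_one, div_one]
  have h1 := norm_expRemainder_I_mul_le_pow_succ m u
  have h2 := norm_expRemainder_I_mul_le_pow m u
  have h3 : 0 ≤ |u| ^ (m + 1) := by positivity
  unfold minPow
  rcases min_choice (|u| ^ m) (|u| ^ (m + 1)) with h' | h' <;> rw [h'] <;> linarith

/-- The exponent m+1 > p handles 0, and m < p handles infinity. -/
theorem integrableOn_minPow_mul_rpow {m : ℕ} {p : ℝ} (h1 : (m : ℝ) < p) (h2 : p < m + 1) :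
    IntegrableOn (fun u => minPow m u * u ^ (-p - 1)) (Set.Ioi 0) := by
  have hmeas : Measurable (fun u : ℝ => minPow m u * u ^ (-p - 1)) :=
    (continuous_minPow m).measurable.mul (measurable_id.pow_const _)
  rw [← Set.Ioc_union_Ioi_eq_Ioi (zero_le_one' ℝ), integrableOn_union]
  constructor
  · have hi : IntegrableOn (fun u : ℝ => u ^ ((m : ℝ) - p)) (Set.Ioc 0 1) := by
      rw [← intervalIntegrable_iff_integrableOn_Ioc_of_le zero_le_one]
      exact intervalIntegral.intervalIntegrable_rpow' (by linarith)
    refine hi.mono' hmeas.aestronglyMeasurable ?_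
    filter_upwards [ae_restrict_mem measurableSet_Ioc] with u hu
    have hu0 : 0 < u := hu.1
    rw [Real.norm_of_nonneg (mul_nonneg (minPow_nonneg m hu0.le) (by positivity))]
    calc _ ≤ u ^ (m + 1) * u ^ (-p - 1) := by gcongr; exact minPow_le_pow_succ m u
      _ = _ := by
        rw [← Real.rpow_natCast, ← Real.rpow_add hu0]; congr 1; push_cast; ring
  · have hi : IntegrableOn (fun u : ℝ => u ^ ((m : ℝ) - p - 1)) (Set.Ioi 1) :=
      integrableOn_Ioi_rpow_of_lt (by linarith) one_pos
    refine hi.mono' hmeas.aestronglyMeasurable ?_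
    filter_upwards [ae_restrict_mem measurableSet_Ioi] with u hu
    have hu0 : 0 < u := one_pos.trans hu
    rw [Real.norm_of_nonneg (mul_nonneg (minPow_nonneg m hu0.le) (by positivity))]
    calc _ ≤ u ^ m * u ^ (-p - 1) := by gcongr; exact minPow_le_pow m u
      _ = _ := by
        rw [← Real.rpow_natCast, ← Real.rpow_add hu0]; congr 1; ring

/-! ### Averaging the kernel against e^(-s). -/

theorem integrableOn_exp_neg_mul_pow (n : ℕ) :
    IntegrableOn (fun s : ℝ => Real.exp (-s) * s ^ n) (Set.Ioi 0) := by
  simpa using Real.GammaIntegral_convergent (s := n + 1) (by positivity)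

theorem integral_exp_neg_mul_pow (n : ℕ) :
    ∫ s in Set.Ioi (0 : ℝ), Real.exp (-s) * s ^ n = n.factorial := by
  have := Real.Gamma_eq_integral (s := n + 1) (by positivity)
  rw [Real.Gamma_nat_eq_factorial] at this
  simpa using this.symm

theorem integrableOn_exp_neg_mul_expRemainder (m : ℕ) (x : ℝ) :
    IntegrableOn (fun s : ℝ => Complex.exp (-s) * expRemainder m (Complex.I * (s * x)))
      (Set.Ioi 0) := by
  have := continuous_expRemainder m
  refine ((integrableOn_exp_neg_mul_pow m).const_mul (2 * |x| ^ m)).mono'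
    (by fun_prop : Continuous _).aestronglyMeasurable ?_
  filter_upwards [ae_restrict_mem measurableSet_Ioi] with s hs
  have hs' : (0 : ℝ) < s := hs
  have h := norm_expRemainder_I_mul_le_pow m (s * x)
  push_cast at h
  rw [norm_mul, ← Complex.ofReal_neg, Complex.norm_exp_ofReal]
  calc _ ≤ Real.exp (-s) * (2 * |s * x| ^ m) := by gcongr
    _ = _ := by rw [abs_mul, abs_of_pos hs', mul_pow]; ring

/-- Termwise, the exponential gives 1/(1 - z) with z = ix and each z^j s^j/j! gives z^j, so what
remains is the tail of a geometric series. -/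
theorem integral_exp_neg_mul_expRemainder (m : ℕ) (x : ℝ) :
    ∫ s in Set.Ioi (0 : ℝ), Complex.exp (-s) * expRemainder m (Complex.I * (s * x)) =
      (Complex.I * x) ^ (m + 1) / (1 - Complex.I * x) := by
  set z : ℂ := Complex.I * x
  have hre : (z - 1).re < 0 := by simp [z]
  have hz : 1 - z ≠ 0 := by
    intro h; rw [← neg_sub, h] at hre; simp at hre
  have hpow : ∀ j : ℕ, IntegrableOn (fun s : ℝ => ((Real.exp (-s) * s ^ j : ℝ) : ℂ)) (Set.Ioi 0) :=
    fun j => (integrableOn_exp_neg_mul_pow j).ofReal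
  have hpowi : ∀ j : ℕ, ∫ s in Set.Ioi (0 : ℝ), ((Real.exp (-s) * s ^ j : ℝ) : ℂ) = j.factorial := by
    intro j
    rw [integral_complex_ofReal, integral_exp_neg_mul_pow]; simp
  have hexp : IntegrableOn (fun s : ℝ => Complex.exp ((z - 1) * s)) (Set.Ioi 0) :=
    integrableOn_exp_mul_complex_Ioi hre 0
  have hfun : ∀ s : ℝ, Complex.exp (-s) * expRemainder m (Complex.I * (s * x)) =
      Complex.exp ((z - 1) * s) - ∑ j ∈ Finset.range (m + 1),
        z ^ j / (j.factorial : ℂ) * ((Real.exp (-s) * s ^ j : ℝ) : ℂ) := by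
    intro s
    rw [expRemainder, mul_sub, ← Complex.exp_add, Finset.mul_sum]
    congr 1
    · congr 1; simp only [z]; ring
    · refine Finset.sum_congr rfl fun j _ => ?_
      push_cast
      simp only [z]
      ring
  simp_rw [hfun]
  rw [integral_sub hexp (integrable_finsetSum _ fun j _ => (hpow j).const_mul _),
    integral_finsetSum _ (fun j _ => (hpow j).const_mul _),
    integral_exp_mul_complex_Ioi hre]
  simp_rw [integral_const_mul, hpowi]
  have : ∀ j ∈ Finset.range (m + 1), z ^ j / (j.factorial : ℂ) * (j.factorial : ℂ) = z ^ j :=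
    fun j _ => div_mul_cancel₀ _ (by exact_mod_cast j.factorial_ne_zero)
  rw [Finset.sum_congr rfl this]
  have hg := mul_neg_geom_sum z (m + 1)
  have hz' : z - 1 ≠ 0 := by intro h; apply hz; rw [← neg_sub, h, neg_zero]
  rw [eq_div_iff hz, sub_mul, mul_comm (∑ j ∈ _, _), hg]
  simp
  field_simp
  ring

/-- The function `x ↦ ∫_0^∞ e^(-s) Re (e_m(i s x) / i^(p+1)) ds` in closed form. -/
noncomputable def averagedKernel (m : ℕ) (p x : ℝ) : ℝ :=
  x ^ (m + 1) * (Real.cos (Real.pi / 2 * (p - m)) + x * Real.sin (Real.pi / 2 * (p - m))) /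
    (1 + x ^ 2)

theorem I_pow_div_I_cpow (m : ℕ) (p : ℝ) :
    Complex.I ^ (m + 1) / Complex.I ^ ((p : ℂ) + 1) =
      Real.cos (Real.pi / 2 * (p - m)) - Real.sin (Real.pi / 2 * (p - m)) * Complex.I := by
  have h : Complex.I ^ (m + 1) = Complex.exp ((m + 1 : ℕ) * ((Real.pi / 2 : ℝ) * Complex.I)) := by
    rw [Complex.exp_nat_mul]
    congr 1
    push_cast
    exact Complex.exp_pi_div_two_mul_I.symm
  rw [h, I_cpow_ofReal_add_one, ← Complex.exp_sub,
    show ((m + 1 : ℕ) : ℂ) * ((Real.pi / 2 : ℝ) * Complex.I) -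
      ((Real.pi / 2 * (p + 1) : ℝ) : ℂ) * Complex.I =
      ((-(Real.pi / 2 * (p - m)) : ℝ) : ℂ) * Complex.I by push_cast; ring,
    Complex.exp_mul_I, ← Complex.ofReal_cos, ← Complex.ofReal_sin, Real.cos_neg, Real.sin_neg]
  push_cast
  ring

theorem averagedKernel_eq_re (m : ℕ) (p x : ℝ) :
    ((Complex.I * x) ^ (m + 1) / (1 - Complex.I * x) / Complex.I ^ ((p : ℂ) + 1)).re =
      averagedKernel m p x := by
  have hx : (1 : ℝ) + x ^ 2 ≠ 0 := by positivity
  have hx' : (1 : ℂ) + (x : ℂ) ^ 2 ≠ 0 := by exact_mod_cast hx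
  have hinv : (1 - Complex.I * (x : ℂ))⁻¹ = (1 + Complex.I * x) / (1 + (x : ℂ) ^ 2) := by
    have hm : (1 - Complex.I * (x : ℂ)) * (1 + Complex.I * x) = 1 + (x : ℂ) ^ 2 := by
      linear_combination (-(x : ℂ) ^ 2) * Complex.I_sq
    have h0 : 1 - Complex.I * (x : ℂ) ≠ 0 := by
      intro h; rw [h, zero_mul] at hm; exact hx' hm.symm
    rw [inv_eq_iff_eq_inv, inv_div, ← hm, mul_div_assoc, div_self, mul_one]
    intro h; rw [h, mul_zero] at hm; exact hx' hm.symm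
  have : (Complex.I * (x : ℂ)) ^ (m + 1) / (1 - Complex.I * x) / Complex.I ^ ((p : ℂ) + 1) =
      ((x ^ (m + 1) / (1 + x ^ 2) : ℝ) : ℂ) *
        ((Real.cos (Real.pi / 2 * (p - m)) - Real.sin (Real.pi / 2 * (p - m)) * Complex.I) *
          (1 + Complex.I * x)) := by
    rw [← I_pow_div_I_cpow, div_eq_mul_inv _ (1 - _), hinv, mul_pow]
    push_cast
    ring
  rw [this, Complex.re_ofReal_mul, averagedKernel]
  generalize Real.cos (Real.pi / 2 * (p - m)) = c
  generalize Real.sin (Real.pi / 2 * (p - m)) = d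
  simp
  ring

theorem integral_exp_neg_mul_remainderKernel (m : ℕ) (p x : ℝ) :
    ∫ s in Set.Ioi (0 : ℝ), Real.exp (-s) * remainderKernel m p (s * x) =
      averagedKernel m p x := by
  rw [← averagedKernel_eq_re, ← integral_exp_neg_mul_expRemainder, ← integral_div]
  have hre := integral_re ((integrableOn_exp_neg_mul_expRemainder m x).div_const
    (Complex.I ^ ((p : ℂ) + 1)))
  simp only [RCLike.re_to_complex] at hre
  rw [← hre]
  refine integral_congr_ae (ae_of_all _ fun s => ?_)
  simp only
  rw [mul_div_assoc, ← Complex.ofReal_neg, ← Complex.ofReal_exp, Complex.re_ofReal_mul,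
    remainderKernel]
  push_cast
  rfl

/-! ### The integral of u^r/(1+u²). -/

/-- Here 1/(1+u²) is expanded as a Laplace integral in s. Integrating in u first leaves two Gamma
integrals whose arguments sum to 1, and the reflection formula finishes. -/
theorem integrable_prod_exp_neg_mul_one_add_sq {r : ℝ} (h1 : -1 < r) (h2 : r < 1) :
    Integrable (fun z : ℝ × ℝ => z.2 ^ r * Real.exp (-z.1 * (1 + z.2 ^ 2)))
      ((volume.restrict (Set.Ioi 0)).prod (volume.restrict (Set.Ioi 0))) ∧
    ∫ s in Set.Ioi (0 : ℝ), ∫ u in Set.Ioi (0 : ℝ), u ^ r * Real.exp (-s * (1 + u ^ 2)) =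
      Real.pi / (2 * Real.cos (Real.pi / 2 * r)) := by
  have hsplit : ∀ s u : ℝ, u ^ r * Real.exp (-s * (1 + u ^ 2)) =
      Real.exp (-s) * (u ^ r * Real.exp (-s * u ^ (2 : ℝ))) := by
    intro s u
    rw [mul_left_comm, ← Real.exp_add, Real.rpow_two]; ring_nf
  have hinner : ∀ s ∈ Set.Ioi (0 : ℝ),
      ∫ u in Set.Ioi (0 : ℝ), u ^ r * Real.exp (-s * (1 + u ^ 2)) =
        Real.Gamma ((r + 1) / 2) / 2 * (Real.exp (-s) * s ^ ((1 - (r + 1) / 2) - 1)) := by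
    intro s hs
    simp_rw [hsplit]
    rw [integral_const_mul, integral_rpow_mul_exp_neg_mul_rpow two_pos h1 hs]
    rw [show 1 - (r + 1) / 2 - 1 = -(r + 1) / 2 by ring]
    ring
  have hg : 0 < 1 - (r + 1) / 2 := by linarith
  constructor
  · have hmeas : AEStronglyMeasurable (fun z : ℝ × ℝ => z.2 ^ r * Real.exp (-z.1 * (1 + z.2 ^ 2)))
        ((volume.restrict (Set.Ioi 0)).prod (volume.restrict (Set.Ioi 0))) := by
      refine Measurable.aestronglyMeasurable ?_
      exact (measurable_snd.pow_const r).mul (by fun_prop)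
    rw [integrable_prod_iff hmeas]
    constructor
    · filter_upwards [ae_restrict_mem measurableSet_Ioi] with s hs
      simp_rw [hsplit]
      exact (integrableOn_rpow_mul_exp_neg_mul_rpow h1 two_pos hs).const_mul _
    · refine ((Real.GammaIntegral_convergent hg).const_mul (Real.Gamma ((r + 1) / 2) / 2)).congr ?_
      filter_upwards [ae_restrict_mem measurableSet_Ioi] with s hs
      rw [← hinner s hs]
      refine setIntegral_congr_fun measurableSet_Ioi fun u hu => ?_
      have hu' : (0 : ℝ) < u := hu
      exact (Real.norm_of_nonneg (by positivity)).symm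
  · rw [setIntegral_congr_fun measurableSet_Ioi hinner, integral_const_mul,
      ← Real.Gamma_eq_integral hg, div_mul_eq_mul_div, Real.Gamma_mul_Gamma_one_sub,
      ← Real.sin_pi_div_two_sub, ← Real.sin_pi_sub, div_div, mul_comm 2]
    congr 3
    ring

theorem integral_rpow_div_one_add_sq {r : ℝ} (h1 : -1 < r) (h2 : r < 1) :
    ∫ u in Set.Ioi (0 : ℝ), u ^ r / (1 + u ^ 2) = Real.pi / (2 * Real.cos (Real.pi / 2 * r)) := by
  obtain ⟨hi, he⟩ := integrable_prod_exp_neg_mul_one_add_sq h1 h2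
  rw [← he, integral_integral_swap hi]
  refine integral_congr_ae (ae_of_all _ fun u => ?_)
  have hu : 0 < 1 + u ^ 2 := by positivity
  have := integral_exp_mul_Ioi (a := -(1 + u ^ 2)) (by linarith) 0
  simp only [integral_const_mul]
  simp_rw [show ∀ s : ℝ, -s * (1 + u ^ 2) = -(1 + u ^ 2) * s by intro s; ring]
  rw [this, neg_div_neg_eq, mul_zero, Real.exp_zero, mul_one_div]

theorem integrableOn_rpow_div_one_add_sq {r : ℝ} (h1 : -1 < r) (h2 : r < 1) :
    IntegrableOn (fun u : ℝ => u ^ r / (1 + u ^ 2)) (Set.Ioi 0) := by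
  -- A non-integrable function has Bochner integral 0, so the positive value just found already
  -- proves integrability.
  refine Integrable.of_integral_ne_zero ?_
  rw [integral_rpow_div_one_add_sq h1 h2]
  have : 0 < Real.cos (Real.pi / 2 * r) :=
    Real.cos_pos_of_mem_Ioo ⟨by nlinarith [Real.pi_pos], by nlinarith [Real.pi_pos]⟩
  positivity

/-! ### Scaling, and full integrals of both kernels over the two rays. -/

theorem setIntegral_comp_mul_mul_rpow (F : ℝ → ℝ) (p : ℝ) {b v : ℝ} (hb : 0 < b) (hv : 0 ≤ v) :
    ∫ t in Set.Ioi v, F (b * t) * t ^ (-p - 1) =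
      b ^ p * ∫ u in Set.Ioi (b * v), F u * u ^ (-p - 1) := by
  have h := integral_comp_mul_left_Ioi (fun u => F u * u ^ (-p - 1)) v hb
  rw [smul_eq_mul] at h
  have h2 : ∫ u in Set.Ioi (b * v), F u * u ^ (-p - 1) =
      b * ∫ t in Set.Ioi v, F (b * t) * (b * t) ^ (-p - 1) := by
    rw [h, mul_inv_cancel_left₀ hb.ne']
  rw [h2, ← mul_assoc, ← integral_const_mul]
  refine setIntegral_congr_fun measurableSet_Ioi fun t ht => ?_
  have ht' : 0 < t := hv.trans_lt ht
  have h3 : b ^ p * b * b ^ (-p - 1) = 1 := by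
    rw [← Real.rpow_add_one hb.ne', ← Real.rpow_add hb]
    simp
  rw [Real.mul_rpow hb.le ht'.le]
  linear_combination (-(F (b * t) * t ^ (-p - 1))) * h3

section

variable {m : ℕ} {p : ℝ}

theorem abs_remainderKernel_mul_le (m : ℕ) (p a b : ℝ) :
    |remainderKernel m p (a * b)| ≤ 2 * (|a| ^ m + |a| ^ (m + 1)) * minPow m |b| := by
  refine (abs_remainderKernel_le m p _).trans ?_
  rw [abs_mul, mul_assoc]
  gcongr
  exact minPow_mul_le m (abs_nonneg a) (abs_nonneg b)

theorem integrableOn_remainderKernel_mul_rpow (h1 : (m : ℝ) < p) (h2 : p < m + 1) (x : ℝ) :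
    IntegrableOn (fun t => remainderKernel m p (x * t) * t ^ (-p - 1)) (Set.Ioi 0) := by
  refine ((integrableOn_minPow_mul_rpow h1 h2).const_mul (2 * (|x| ^ m + |x| ^ (m + 1)))).mono'
    (Measurable.aestronglyMeasurable ?_) ?_
  · exact ((continuous_remainderKernel m p).measurable.comp (measurable_const_mul x)).mul
      (measurable_id.pow_const _)
  · filter_upwards [ae_restrict_mem measurableSet_Ioi] with t ht
    have ht' : (0 : ℝ) < t := ht
    have h := abs_remainderKernel_mul_le m p x t
    rw [abs_of_pos ht'] at h
    rw [norm_mul, Real.norm_eq_abs, Real.norm_of_nonneg (by positivity : 0 ≤ t ^ (-p - 1)),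
      ← mul_assoc]
    gcongr

theorem integrable_prod_exp_neg_mul_remainderKernel (h1 : (m : ℝ) < p) (h2 : p < m + 1)
    (x : ℝ) {v : ℝ} (hv : 0 ≤ v) :
    Integrable (fun z : ℝ × ℝ =>
      Real.exp (-z.1) * (remainderKernel m p (z.1 * (x * z.2)) * z.2 ^ (-p - 1)))
      ((volume.restrict (Set.Ioi 0)).prod (volume.restrict (Set.Ioi v))) := by
  have hs : Integrable (fun s : ℝ => Real.exp (-s) * s ^ m + Real.exp (-s) * s ^ (m + 1))
      (volume.restrict (Set.Ioi 0)) :=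
    (integrableOn_exp_neg_mul_pow m).add (integrableOn_exp_neg_mul_pow (m + 1))
  have ht : Integrable (fun t => 2 * (|x| ^ m + |x| ^ (m + 1)) * (minPow m t * t ^ (-p - 1)))
      (volume.restrict (Set.Ioi v)) :=
    ((integrableOn_minPow_mul_rpow h1 h2).mono_set (Set.Ioi_subset_Ioi hv)).const_mul _
  refine (hs.mul_prod ht).mono' (Measurable.aestronglyMeasurable ?_) ?_
  · exact (by fun_prop : Measurable fun z : ℝ × ℝ => Real.exp (-z.1)).mul
      (((continuous_remainderKernel m p).measurable.comp (by fun_prop)).mul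
        (measurable_snd.pow_const _))
  · rw [Measure.prod_restrict]
    filter_upwards [ae_restrict_mem (measurableSet_Ioi.prod measurableSet_Ioi)] with z hz
    have hs' : (0 : ℝ) < z.1 := hz.1
    have ht' : (0 : ℝ) < z.2 := hv.trans_lt hz.2
    have h := abs_remainderKernel_mul_le m p z.1 (x * z.2)
    rw [abs_of_pos hs', abs_mul, abs_of_pos ht'] at h
    have h' := minPow_mul_le m (abs_nonneg x) ht'.le
    rw [norm_mul, norm_mul, Real.norm_of_nonneg (Real.exp_pos _).le, Real.norm_eq_abs,
      Real.norm_of_nonneg (by positivity : 0 ≤ z.2 ^ (-p - 1))]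
    calc _ ≤ Real.exp (-z.1) * (2 * (z.1 ^ m + z.1 ^ (m + 1)) *
          ((|x| ^ m + |x| ^ (m + 1)) * minPow m z.2) * z.2 ^ (-p - 1)) := by
          gcongr
          exact h.trans (by gcongr)
      _ = _ := by ring

theorem integral_exp_neg_mul_integral_remainderKernel (h1 : (m : ℝ) < p) (h2 : p < m + 1)
    (x : ℝ) {v : ℝ} (hv : 0 ≤ v) :
    ∫ s in Set.Ioi (0 : ℝ), Real.exp (-s) *
        ∫ t in Set.Ioi v, remainderKernel m p (s * (x * t)) * t ^ (-p - 1) =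
      ∫ t in Set.Ioi v, averagedKernel m p (x * t) * t ^ (-p - 1) := by
  simp_rw [← integral_const_mul]
  rw [integral_integral_swap (integrable_prod_exp_neg_mul_remainderKernel h1 h2 x hv)]
  refine integral_congr_ae (ae_of_all _ fun t => ?_)
  simp only [← mul_assoc]
  rw [integral_mul_const]
  simp_rw [mul_assoc]
  rw [integral_exp_neg_mul_remainderKernel]

theorem integrableOn_averagedKernel_mul_rpow (h1 : (m : ℝ) < p) (h2 : p < m + 1) (x : ℝ) :
    IntegrableOn (fun t => averagedKernel m p (x * t) * t ^ (-p - 1)) (Set.Ioi 0) := by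
  have h := (integrable_prod_exp_neg_mul_remainderKernel h1 h2 x le_rfl).integral_prod_right
  refine h.congr (ae_of_all _ fun t => ?_)
  simp only [← mul_assoc]
  rw [integral_mul_const]
  simp_rw [mul_assoc]
  rw [integral_exp_neg_mul_remainderKernel]

/-- Rescaling t by s contributes s^p, and averaging s^p against e^(-s) gives Γ(p+1). -/
theorem Gamma_mul_integral_remainderKernel (h1 : (m : ℝ) < p) (h2 : p < m + 1) (x : ℝ) :
    Real.Gamma (p + 1) * ∫ t in Set.Ioi (0 : ℝ), remainderKernel m p (x * t) * t ^ (-p - 1) =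
      ∫ t in Set.Ioi (0 : ℝ), averagedKernel m p (x * t) * t ^ (-p - 1) := by
  have hp : 0 < p := (Nat.cast_nonneg m).trans_lt h1
  rw [← integral_exp_neg_mul_integral_remainderKernel h1 h2 x le_rfl,
    Real.Gamma_eq_integral (by linarith), ← integral_mul_const]
  refine setIntegral_congr_fun measurableSet_Ioi fun s hs => ?_
  have h := setIntegral_comp_mul_mul_rpow (fun u => remainderKernel m p (x * u)) p
    (Set.mem_Ioi.mp hs) le_rfl
  simp only [mul_zero] at h
  simp only [add_sub_cancel_right]
  rw [mul_assoc, ← h]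
  simp only [mul_left_comm]

theorem averagedKernel_mul_rpow {t : ℝ} (ht : 0 < t) :
    averagedKernel m p t * t ^ (-p - 1) =
      Real.cos (Real.pi / 2 * (p - m)) * (t ^ ((m : ℝ) - p) / (1 + t ^ 2)) +
      Real.sin (Real.pi / 2 * (p - m)) * (t ^ ((m : ℝ) + 1 - p) / (1 + t ^ 2)) := by
  rw [show (m : ℝ) - p = (m + 1 : ℕ) + (-p - 1) by push_cast; ring,
    show (m : ℝ) + 1 - p = (m + 1 : ℕ) + (-p - 1) + 1 by push_cast; ring,
    Real.rpow_add_one ht.ne', Real.rpow_add ht, Real.rpow_natCast, averagedKernel]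
  ring

theorem averagedKernel_neg_mul_rpow {t : ℝ} (ht : 0 < t) :
    averagedKernel m p (-t) * t ^ (-p - 1) = (-1) ^ (m + 1) *
      (Real.cos (Real.pi / 2 * (p - m)) * (t ^ ((m : ℝ) - p) / (1 + t ^ 2)) -
      Real.sin (Real.pi / 2 * (p - m)) * (t ^ ((m : ℝ) + 1 - p) / (1 + t ^ 2))) := by
  rw [show (m : ℝ) - p = (m + 1 : ℕ) + (-p - 1) by push_cast; ring,
    show (m : ℝ) + 1 - p = (m + 1 : ℕ) + (-p - 1) + 1 by push_cast; ring,
    Real.rpow_add_one ht.ne', Real.rpow_add ht, Real.rpow_natCast, averagedKernel, neg_pow]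
  ring

/-- The cosine and sine parts of the averaged kernel each contribute π/2: they add up on the
positive ray and cancel on the negative one. -/
theorem cos_mul_integral_rpow_div (h1 : (m : ℝ) < p) (h2 : p < m + 1) :
    Real.cos (Real.pi / 2 * (p - m)) * ∫ t in Set.Ioi (0 : ℝ), t ^ ((m : ℝ) - p) / (1 + t ^ 2) =
      Real.pi / 2 := by
  have hc : 0 < Real.cos (Real.pi / 2 * (p - m)) :=
    Real.cos_pos_of_mem_Ioo ⟨by nlinarith [Real.pi_pos], by nlinarith [Real.pi_pos]⟩
  rw [integral_rpow_div_one_add_sq (by linarith) (by linarith),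
    show Real.pi / 2 * (m - p) = -(Real.pi / 2 * (p - m)) by ring, Real.cos_neg, ← div_div,
    mul_div_cancel₀ _ hc.ne']

theorem sin_mul_integral_rpow_div (h1 : (m : ℝ) < p) (h2 : p < m + 1) :
    Real.sin (Real.pi / 2 * (p - m)) *
      ∫ t in Set.Ioi (0 : ℝ), t ^ ((m : ℝ) + 1 - p) / (1 + t ^ 2) = Real.pi / 2 := by
  have hc : 0 < Real.sin (Real.pi / 2 * (p - m)) :=
    Real.sin_pos_of_mem_Ioo ⟨by nlinarith [Real.pi_pos], by nlinarith [Real.pi_pos]⟩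
  rw [integral_rpow_div_one_add_sq (by linarith) (by linarith),
    show Real.pi / 2 * (m + 1 - p) = Real.pi / 2 - (Real.pi / 2 * (p - m)) by ring,
    Real.cos_pi_div_two_sub, ← div_div, mul_div_cancel₀ _ hc.ne']

theorem integral_averagedKernel (h1 : (m : ℝ) < p) (h2 : p < m + 1) :
    ∫ t in Set.Ioi (0 : ℝ), averagedKernel m p t * t ^ (-p - 1) = Real.pi := by
  rw [setIntegral_congr_fun measurableSet_Ioi fun t ht => averagedKernel_mul_rpow ht,
    integral_add ((integrableOn_rpow_div_one_add_sq (by linarith) (by linarith)).const_mul _)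
      ((integrableOn_rpow_div_one_add_sq (by linarith) (by linarith)).const_mul _),
    integral_const_mul, integral_const_mul, cos_mul_integral_rpow_div h1 h2,
    sin_mul_integral_rpow_div h1 h2, add_halves]

theorem integral_averagedKernel_neg (h1 : (m : ℝ) < p) (h2 : p < m + 1) :
    ∫ t in Set.Ioi (0 : ℝ), averagedKernel m p (-t) * t ^ (-p - 1) = 0 := by
  rw [setIntegral_congr_fun measurableSet_Ioi fun t ht => averagedKernel_neg_mul_rpow ht,
    integral_const_mul,
    integral_sub ((integrableOn_rpow_div_one_add_sq (by linarith) (by linarith)).const_mul _)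
      ((integrableOn_rpow_div_one_add_sq (by linarith) (by linarith)).const_mul _),
    integral_const_mul, integral_const_mul, cos_mul_integral_rpow_div h1 h2,
    sin_mul_integral_rpow_div h1 h2, sub_self, mul_zero]

theorem integral_remainderKernel (h1 : (m : ℝ) < p) (h2 : p < m + 1) :
    ∫ t in Set.Ioi (0 : ℝ), remainderKernel m p t * t ^ (-p - 1) =
      Real.pi / Real.Gamma (p + 1) := by
  have hp : 0 < p := (Nat.cast_nonneg m).trans_lt h1
  have h := Gamma_mul_integral_remainderKernel h1 h2 1
  simp only [one_mul] at h
  rw [integral_averagedKernel h1 h2] at h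
  rw [eq_div_iff (Real.Gamma_pos_of_pos (by linarith)).ne', mul_comm, h]

theorem integral_remainderKernel_neg (h1 : (m : ℝ) < p) (h2 : p < m + 1) :
    ∫ t in Set.Ioi (0 : ℝ), remainderKernel m p (-t) * t ^ (-p - 1) = 0 := by
  have hp : 0 < p := (Nat.cast_nonneg m).trans_lt h1
  have h := Gamma_mul_integral_remainderKernel h1 h2 (-1)
  simp only [neg_one_mul] at h
  rw [integral_averagedKernel_neg h1 h2] at h
  exact (mul_eq_zero.mp h).resolve_left (Real.Gamma_pos_of_pos (by linarith)).ne'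

end

/-! ### Size and sign of the tail integrals. -/

/-- The normalized tail integral `a ↦ ∫_1^∞ Re (e_m(i a s) / i^(p+1)) s^(-p-1) ds`. -/
noncomputable def kernelTail (m : ℕ) (p a : ℝ) : ℝ :=
  ∫ s in Set.Ioi (1 : ℝ), remainderKernel m p (a * s) * s ^ (-p - 1)

/-- The normalized tail integral of the averaged kernel. -/
noncomputable def averagedTail (m : ℕ) (p a : ℝ) : ℝ :=
  ∫ s in Set.Ioi (1 : ℝ), averagedKernel m p (a * s) * s ^ (-p - 1)

section

variable {m : ℕ} {p : ℝ}

theorem kernelTail_zero (m : ℕ) (p : ℝ) : kernelTail m p 0 = 0 := by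
  simp [kernelTail, remainderKernel_zero]

theorem measurable_kernelTail (m : ℕ) (p : ℝ) : Measurable (kernelTail m p) := by
  have h : Measurable (fun z : ℝ × ℝ => remainderKernel m p (z.1 * z.2) * z.2 ^ (-p - 1)) :=
    ((continuous_remainderKernel m p).measurable.comp (by fun_prop)).mul
      (measurable_snd.pow_const _)
  exact (h.stronglyMeasurable.integral_prod_right (ν := volume.restrict (Set.Ioi 1))).measurable

theorem kernelTail_eq {a : ℝ} (ha : 0 < a) :
    kernelTail m p a = a ^ p * ∫ u in Set.Ioi a, remainderKernel m p u * u ^ (-p - 1) := by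
  simpa [kernelTail] using setIntegral_comp_mul_mul_rpow (remainderKernel m p) p ha zero_le_one

theorem kernelTail_neg_eq {a : ℝ} (ha : 0 < a) :
    kernelTail m p (-a) = a ^ p * ∫ u in Set.Ioi a, remainderKernel m p (-u) * u ^ (-p - 1) := by
  simpa [kernelTail] using
    setIntegral_comp_mul_mul_rpow (fun u => remainderKernel m p (-u)) p ha zero_le_one

theorem averagedTail_neg_eq {a : ℝ} (ha : 0 < a) :
    averagedTail m p (-a) = a ^ p * ∫ u in Set.Ioi a, averagedKernel m p (-u) * u ^ (-p - 1) := by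
  simpa [averagedTail] using
    setIntegral_comp_mul_mul_rpow (fun u => averagedKernel m p (-u)) p ha zero_le_one

theorem integral_exp_neg_mul_kernelTail (h1 : (m : ℝ) < p) (h2 : p < m + 1) (a : ℝ) :
    ∫ s in Set.Ioi (0 : ℝ), Real.exp (-s) * kernelTail m p (s * a) = averagedTail m p a := by
  rw [averagedTail, ← integral_exp_neg_mul_integral_remainderKernel h1 h2 a zero_le_one]
  simp only [kernelTail, mul_assoc]

theorem abs_kernelTail_le_pow (h1 : (m : ℝ) < p) (a : ℝ) :
    |kernelTail m p a| ≤ 2 / (p - m) * |a| ^ m := by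
  have hi : IntegrableOn (fun s : ℝ => 2 * |a| ^ m * s ^ ((m : ℝ) - p - 1)) (Set.Ioi 1) :=
    (integrableOn_Ioi_rpow_of_lt (by linarith) one_pos).const_mul _
  rw [kernelTail, ← Real.norm_eq_abs]
  refine (norm_integral_le_of_norm_le hi ?_).trans_eq ?_
  · filter_upwards [ae_restrict_mem measurableSet_Ioi] with s hs
    have hs' : (0 : ℝ) < s := one_pos.trans (Set.mem_Ioi.mp hs)
    have h := (abs_remainderKernel_le m p (a * s)).trans
      (mul_le_mul_of_nonneg_left (minPow_le_pow m _) zero_le_two)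
    rw [norm_mul, Real.norm_eq_abs, Real.norm_of_nonneg (by positivity : 0 ≤ s ^ (-p - 1))]
    calc _ ≤ 2 * |a * s| ^ m * s ^ (-p - 1) := by gcongr
      _ = _ := by
        rw [show (m : ℝ) - p - 1 = m + (-p - 1) by ring, Real.rpow_add hs', Real.rpow_natCast,
          abs_mul, abs_of_pos hs', mul_pow]
        ring
  · rw [integral_const_mul, integral_Ioi_rpow_of_lt (by linarith) one_pos, Real.one_rpow,
      show (m : ℝ) - p - 1 + 1 = -(p - m) by ring, neg_div_neg_eq]
    ring

theorem integrableOn_remainderKernel_neg_mul_rpow (h1 : (m : ℝ) < p) (h2 : p < m + 1) :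
    IntegrableOn (fun t => remainderKernel m p (-t) * t ^ (-p - 1)) (Set.Ioi 0) := by
  simpa using integrableOn_remainderKernel_mul_rpow h1 h2 (-1)

/-- Because the full integral vanishes, the integral over (a, ∞) is minus that over (0, a], where
the kernel is O(u^(m+1)). -/
theorem abs_kernelTail_neg_le_pow_succ (h1 : (m : ℝ) < p) (h2 : p < m + 1) {a : ℝ} (ha : 0 ≤ a) :
    |kernelTail m p (-a)| ≤ 2 / (m + 1 - p) * a ^ (m + 1) := by
  rcases ha.eq_or_lt with rfl | ha'
  · simp [kernelTail_zero]
  have hI := integrableOn_remainderKernel_neg_mul_rpow h1 h2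
  have hsplit := setIntegral_union Set.Ioc_disjoint_Ioi_same measurableSet_Ioi
    (hI.mono_set (Set.Ioc_subset_Ioi_self : Set.Ioc 0 a ⊆ _)) (hI.mono_set (Set.Ioi_subset_Ioi ha))
  rw [Set.Ioc_union_Ioi_eq_Ioi ha, integral_remainderKernel_neg h1 h2] at hsplit
  have hi : IntegrableOn (fun s : ℝ => 2 * s ^ ((m : ℝ) - p)) (Set.Ioc 0 a) := by
    rw [← intervalIntegrable_iff_integrableOn_Ioc_of_le ha]
    exact (intervalIntegral.intervalIntegrable_rpow' (by linarith)).const_mul _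
  have hb : |∫ u in Set.Ioc 0 a, remainderKernel m p (-u) * u ^ (-p - 1)| ≤
      2 * (a ^ ((m : ℝ) + 1 - p) / (m + 1 - p)) := by
    rw [← Real.norm_eq_abs]
    refine (norm_integral_le_of_norm_le hi ?_).trans_eq ?_
    · filter_upwards [ae_restrict_mem measurableSet_Ioc] with s hs
      have hs' : (0 : ℝ) < s := hs.1
      have h := (abs_remainderKernel_le m p (-s)).trans
        (mul_le_mul_of_nonneg_left (minPow_le_pow_succ m _) zero_le_two)
      rw [norm_mul, Real.norm_eq_abs, Real.norm_of_nonneg (by positivity : 0 ≤ s ^ (-p - 1))]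
      calc _ ≤ 2 * |-s| ^ (m + 1) * s ^ (-p - 1) := by gcongr
        _ = _ := by
          rw [show (m : ℝ) - p = (m + 1 : ℕ) + (-p - 1) by push_cast; ring, Real.rpow_add hs',
            Real.rpow_natCast, abs_neg, abs_of_pos hs']
          ring
    · rw [integral_const_mul, ← intervalIntegral.integral_of_le ha,
        integral_rpow (Or.inl (by linarith)), Real.zero_rpow (by linarith), sub_zero,
        show (m : ℝ) - p + 1 = m + 1 - p by ring]
  have hpos : 0 ≤ a ^ p := by positivity
  rw [kernelTail_neg_eq ha', abs_mul, abs_of_nonneg hpos,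
    show ∫ u in Set.Ioi a, remainderKernel m p (-u) * u ^ (-p - 1) =
      -∫ u in Set.Ioc 0 a, remainderKernel m p (-u) * u ^ (-p - 1) by linarith, abs_neg]
  calc _ ≤ a ^ p * (2 * (a ^ ((m : ℝ) + 1 - p) / (m + 1 - p))) := by gcongr
    _ = 2 / (m + 1 - p) * (a ^ p * a ^ ((m : ℝ) + 1 - p)) := by ring
    _ = _ := by
      rw [← Real.rpow_add ha', ← Real.rpow_natCast]
      congr 2
      push_cast
      ring

theorem exists_abs_kernelTail_neg_le_minPow (h1 : (m : ℝ) < p) (h2 : p < m + 1) :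
    ∃ C : ℝ, 0 ≤ C ∧ ∀ a : ℝ, 0 ≤ a → |kernelTail m p (-a)| ≤ C * minPow m a := by
  refine ⟨max (2 / (p - m)) (2 / (m + 1 - p)), ?_, fun a ha => ?_⟩
  · exact le_max_of_le_left (div_nonneg zero_le_two (by linarith))
  · have e1 := abs_kernelTail_le_pow h1 (-a)
    have e2 := abs_kernelTail_neg_le_pow_succ h1 h2 ha
    rw [abs_neg, abs_of_nonneg ha] at e1
    unfold minPow
    rcases min_choice (a ^ m) (a ^ (m + 1)) with h' | h' <;> rw [h']
    · exact e1.trans (by gcongr; exact le_max_left _ _)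
    · exact e2.trans (by gcongr; exact le_max_right _ _)

theorem exists_abs_kernelTail_le_rpow (h1 : (m : ℝ) < p) (h2 : p < m + 1) :
    ∃ D : ℝ, 0 ≤ D ∧ ∀ a : ℝ, 0 ≤ a → |kernelTail m p a| ≤ D * a ^ p := by
  have hI := integrableOn_remainderKernel_mul_rpow h1 h2 1
  simp only [one_mul] at hI
  -- After rescaling, the factor multiplying a^p is a tail of this absolutely convergent integral.
  refine ⟨∫ t in Set.Ioi (0 : ℝ), ‖remainderKernel m p t * t ^ (-p - 1)‖,
    integral_nonneg fun _ => norm_nonneg _, fun a ha => ?_⟩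
  rcases ha.eq_or_lt with rfl | ha'
  · rw [kernelTail_zero, abs_zero]
    exact mul_nonneg (integral_nonneg fun _ => norm_nonneg _) (by positivity)
  · rw [kernelTail_eq ha', abs_mul, abs_of_nonneg (by positivity : 0 ≤ a ^ p), mul_comm]
    rw [← Real.norm_eq_abs]
    gcongr
    refine (norm_integral_le_integral_norm _).trans ?_
    exact setIntegral_mono_set hI.norm (ae_of_all _ fun _ => norm_nonneg _)
      (Set.Ioi_subset_Ioi ha).eventuallyLE

theorem tendsto_rpow_neg_mul_kernelTail (h1 : (m : ℝ) < p) (h2 : p < m + 1) :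
    Tendsto (fun a => a ^ (-p) * kernelTail m p a) (𝓝[>] 0)
      (𝓝 (Real.pi / Real.Gamma (p + 1))) := by
  have hI := integrableOn_remainderKernel_mul_rpow h1 h2 1
  simp only [one_mul] at hI
  rw [← integral_remainderKernel h1 h2]
  have hc := (aecover_Ioi_of_Ioi (μ := volume) (A := (0 : ℝ)) (l := 𝓝[>] 0) (a := id)
    (tendsto_id.mono_left nhdsWithin_le_nhds)).integral_tendsto_of_countably_generated hI
  refine hc.congr' ?_
  filter_upwards [self_mem_nhdsWithin] with a ha
  have ha' : (0 : ℝ) < a := ha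
  rw [kernelTail_eq ha', ← mul_assoc, ← Real.rpow_add ha', neg_add_cancel, Real.rpow_zero, one_mul,
    Measure.restrict_restrict measurableSet_Ioi, id, Set.inter_eq_left.mpr
      (Set.Ioi_subset_Ioi ha'.le)]

theorem neg_one_pow_mul_averagedKernel_neg (m : ℕ) (p u : ℝ) :
    (-1) ^ m * averagedKernel m p (-u) =
      u ^ (m + 1) * (u * Real.sin (Real.pi / 2 * (p - m)) - Real.cos (Real.pi / 2 * (p - m))) /
        (1 + u ^ 2) := by
  have h : ((-1 : ℝ) ^ m) * (-1) ^ m = 1 := by rw [← mul_pow]; simp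
  rw [averagedKernel, neg_pow u, pow_succ (-1 : ℝ), neg_sq]
  linear_combination (u ^ (m + 1) * (u * Real.sin (Real.pi / 2 * (p - m)) -
    Real.cos (Real.pi / 2 * (p - m))) / (1 + u ^ 2)) * h

theorem sin_pi_div_two_mul_sub_pos (h1 : (m : ℝ) < p) (h2 : p < m + 1) :
    0 < Real.sin (Real.pi / 2 * (p - m)) :=
  Real.sin_pos_of_mem_Ioo ⟨by nlinarith [Real.pi_pos], by nlinarith [Real.pi_pos]⟩

theorem integrableOn_averagedKernel_neg_mul_rpow (h1 : (m : ℝ) < p) (h2 : p < m + 1) :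
    IntegrableOn (fun t => averagedKernel m p (-t) * t ^ (-p - 1)) (Set.Ioi 0) := by
  simpa using integrableOn_averagedKernel_mul_rpow h1 h2 (-1)

/-- After multiplication by (-1)^m the integrand is nonpositive up to u = cot(π(p-m)/2), nonnegative
beyond, and of total integral 0. Beyond that point the tail is visibly nonnegative; before it, the
tail is minus a nonpositive integral. -/
theorem averagedTail_neg_nonneg (h1 : (m : ℝ) < p) (h2 : p < m + 1) {a : ℝ} (ha : 0 ≤ a) :
    0 ≤ (-1) ^ m * averagedTail m p (-a) := by
  rcases ha.eq_or_lt with rfl | ha'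
  · simp [averagedTail, averagedKernel]
  rw [averagedTail_neg_eq ha', mul_left_comm]
  refine mul_nonneg (by positivity) ?_
  have hs := sin_pi_div_two_mul_sub_pos h1 h2
  rcases le_total (Real.cos (Real.pi / 2 * (p - m))) (a * Real.sin (Real.pi / 2 * (p - m)))
    with h | h
  · rw [← integral_const_mul]
    refine setIntegral_nonneg measurableSet_Ioi fun u hu => ?_
    have hu' : a < u := hu
    have hu0 : 0 < u := ha'.trans hu'
    rw [← mul_assoc, neg_one_pow_mul_averagedKernel_neg]
    have : 0 ≤ u * Real.sin (Real.pi / 2 * (p - m)) - Real.cos (Real.pi / 2 * (p - m)) := by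
      nlinarith
    positivity
  · have hI := integrableOn_averagedKernel_neg_mul_rpow h1 h2
    have hsplit := setIntegral_union Set.Ioc_disjoint_Ioi_same measurableSet_Ioi
      (hI.mono_set (Set.Ioc_subset_Ioi_self : Set.Ioc 0 a ⊆ _)) (hI.mono_set (Set.Ioi_subset_Ioi ha))
    rw [Set.Ioc_union_Ioi_eq_Ioi ha, integral_averagedKernel_neg h1 h2] at hsplit
    rw [show ∫ u in Set.Ioi a, averagedKernel m p (-u) * u ^ (-p - 1) =
      -∫ u in Set.Ioc 0 a, averagedKernel m p (-u) * u ^ (-p - 1) by linarith, mul_neg,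
      ← integral_const_mul, neg_nonneg]
    refine setIntegral_nonpos measurableSet_Ioc fun u hu => ?_
    have hu0 : 0 < u := hu.1
    rw [← mul_assoc, neg_one_pow_mul_averagedKernel_neg]
    have : u * Real.sin (Real.pi / 2 * (p - m)) - Real.cos (Real.pi / 2 * (p - m)) ≤ 0 := by
      nlinarith [hu.2]
    exact mul_nonpos_of_nonpos_of_nonneg (div_nonpos_of_nonpos_of_nonneg
      (mul_nonpos_of_nonneg_of_nonpos (by positivity) this) (by positivity)) (by positivity)

theorem exists_le_averagedTail_neg (h1 : (m : ℝ) < p) (h2 : p < m + 1) :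
    ∃ c A : ℝ, 0 < c ∧ 0 < A ∧ ∀ a : ℝ, A ≤ a → c ≤ (-1) ^ m * averagedTail m p (-a) := by
  have hp : 0 < p := (Nat.cast_nonneg m).trans_lt h1
  have hs := sin_pi_div_two_mul_sub_pos h1 h2
  set σ := Real.sin (Real.pi / 2 * (p - m)) with hσ
  set κ := Real.cos (Real.pi / 2 * (p - m)) with hκ
  -- For u ≥ 2κ/σ, subtracting κ costs at most half of uσ; for u ≥ 1, 1 + u² ≤ 2u². The kernel is
  -- then at least σ/4, and 1/p is the integral of s^(-p-1) over (1, ∞).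
  refine ⟨σ / 4 * (1 / p), max 1 (2 * κ / σ), by positivity, by positivity, fun a ha => ?_⟩
  have ha1 : 1 ≤ a := (le_max_left _ _).trans ha
  have ha2 : 2 * κ ≤ a * σ := (div_le_iff₀ hs).mp ((le_max_right _ _).trans ha)
  have hint : ∫ s in Set.Ioi (1 : ℝ), σ / 4 * s ^ (-p - 1) = σ / 4 * (1 / p) := by
    rw [integral_const_mul, integral_Ioi_rpow_of_lt (by linarith) one_pos, Real.one_rpow]
    simp
  rw [← hint, averagedTail, ← integral_const_mul]
  have hI := ((integrableOn_averagedKernel_mul_rpow h1 h2 (-a)).mono_set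
    (Set.Ioi_subset_Ioi (zero_le_one' ℝ))).const_mul ((-1) ^ m)
  refine setIntegral_mono_on ((integrableOn_Ioi_rpow_of_lt (by linarith) one_pos).const_mul _)
    hI measurableSet_Ioi fun s hs1 => ?_
  have hs1' : 1 < s := hs1
  have hu1 : 1 ≤ a * s := by nlinarith
  have hu2 : 2 * κ ≤ a * s * σ := by nlinarith [mul_pos (one_pos.trans_le ha1) hs]
  rw [← mul_assoc, neg_mul, neg_one_pow_mul_averagedKernel_neg, ← hσ, ← hκ]
  refine mul_le_mul_of_nonneg_right ?_ (Real.rpow_nonneg (by linarith) _)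
  generalize a * s = u at hu1 hu2
  rw [le_div_iff₀ (by positivity)]
  have e1 : u * (u * σ / 2) ≤ u ^ (m + 1) * (u * σ - κ) := by
    have : u ≤ u ^ (m + 1) := le_self_pow₀ hu1 (by simp)
    have h3 : u * σ / 2 ≤ u * σ - κ := by linarith
    have : 0 ≤ u * σ / 2 := by positivity
    gcongr
  nlinarith [mul_nonneg hs.le (by nlinarith : 0 ≤ u ^ 2 - 1)]

end

/-! ### From the moment integrand to expected tail integrals; the positive part. -/

theorem natCast_ell_lt {p : ℝ} (hp : 0 < p) : (ell p : ℝ) < p := by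
  unfold ell
  rcases le_total p 1 with h | h
  · rw [Nat.ceil_eq_zero.mpr (by linarith)]
    simpa using hp
  · linarith [Nat.ceil_lt_add_one (show 0 ≤ p - 1 by linarith)]

theorem lt_natCast_ell_add_one {p : ℝ} (hp_int : ∀ n : ℕ, p ≠ (n : ℝ)) : p < ell p + 1 := by
  have h : p - 1 ≤ ell p := Nat.le_ceil _
  have h' := hp_int (ell p + 1)
  push_cast at h'
  exact lt_of_le_of_ne (by linarith) h'

section

variable {Ω : Type*} [MeasurableSpace Ω] {P : Measure Ω}
  {m : ℕ} {p : ℝ} {X Y : Ω → ℝ}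

theorem integrable_kernelTail_comp (h1 : (m : ℝ) < p) (hX : AEMeasurable X P)
    (hXm : Integrable (fun ω => |X ω| ^ m) P) : Integrable (fun ω => kernelTail m p (X ω)) P :=
  (hXm.const_mul (2 / (p - m))).mono'
    ((measurable_kernelTail m p).comp_aemeasurable hX).aestronglyMeasurable
    (ae_of_all _ fun _ => abs_kernelTail_le_pow h1 _)

theorem momentIntegrand_eq (hX : AEMeasurable X P)
    (hXm : Integrable (fun ω => |X ω| ^ ell p) P) {t : ℝ} (ht : 0 < t) :
    momentIntegrand P X p t =
      ∫ ω, remainderKernel (ell p) p (X ω * t) * t ^ (-p - 1) ∂P := by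
  have hcont := continuous_expRemainder (ell p)
  have hi : Integrable (fun ω => expRemainder (ell p) (Complex.I * (t : ℂ) * (X ω : ℂ))) P := by
    refine (hXm.const_mul (2 * t ^ ell p)).mono' ?_ (ae_of_all _ fun ω => ?_)
    · exact ((by fun_prop : Continuous fun x : ℝ =>
        expRemainder (ell p) (Complex.I * (t : ℂ) * (x : ℂ))).measurable.comp_aemeasurable
          hX).aestronglyMeasurable
    · have h := norm_expRemainder_I_mul_le_pow (ell p) (t * X ω)
      rw [abs_mul, abs_of_pos ht, mul_pow, ← mul_assoc] at h
      push_cast at h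
      rwa [← mul_assoc] at h
  -- For t > 0 the principal logarithm is additive on i · t, so the principal power factors.
  have hpow : (Complex.I * (t : ℂ)) ^ ((p : ℂ) + 1) =
      ((t ^ (p + 1) : ℝ) : ℂ) * Complex.I ^ ((p : ℂ) + 1) := by
    have ht0 : (t : ℂ) ≠ 0 := by exact_mod_cast ht.ne'
    rw [Complex.cpow_def_of_ne_zero (mul_ne_zero Complex.I_ne_zero ht0),
      Complex.log_mul_ofReal t ht _ Complex.I_ne_zero, add_mul, Complex.exp_add,
      ← Complex.cpow_def_of_ne_zero Complex.I_ne_zero, Complex.ofReal_cpow ht.le,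
      Complex.cpow_def_of_ne_zero ht0, Complex.ofReal_log ht.le]
    push_cast
    rfl
  rw [momentIntegrand, hpow, ← integral_div]
  have hre := integral_re (hi.div_const
    (((t ^ (p + 1) : ℝ) : ℂ) * Complex.I ^ ((p : ℂ) + 1)))
  simp only [RCLike.re_to_complex] at hre
  rw [← hre]
  refine integral_congr_ae (ae_of_all _ fun ω => ?_)
  simp only
  rw [mul_comm ((t ^ (p + 1) : ℝ) : ℂ), ← div_div, Complex.div_ofReal_re, remainderKernel,
    show -p - 1 = -(p + 1) by ring, Real.rpow_neg ht.le, div_eq_mul_inv]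
  push_cast
  rw [mul_comm (X ω : ℂ), mul_assoc]

/-- The dominating product 2 t^(m-p-1) |x|^m uses only the m-th moment. Its t-factor is not
integrable at 0, so v must be positive. -/
theorem integrable_prod_remainderKernel [SFinite P] (h1 : (m : ℝ) < p)
    (hX : AEMeasurable X P) (hXm : Integrable (fun ω => |X ω| ^ m) P) {v : ℝ} (hv : 0 < v) :
    Integrable (fun z : ℝ × Ω => remainderKernel m p (X z.2 * z.1) * z.1 ^ (-p - 1))
      ((volume.restrict (Set.Ioi v)).prod P) := by
  have ht : Integrable (fun t : ℝ => 2 * t ^ ((m : ℝ) - p - 1)) (volume.restrict (Set.Ioi v)) :=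
    (integrableOn_Ioi_rpow_of_lt (by linarith) hv).const_mul _
  refine (ht.mul_prod hXm).mono' (AEMeasurable.aestronglyMeasurable ?_) ?_
  · exact ((continuous_remainderKernel m p).measurable.comp_aemeasurable
      (hX.comp_snd.mul measurable_fst.aemeasurable)).mul (measurable_fst.pow_const _).aemeasurable
  · have hae : ∀ᵐ z ∂((volume.restrict (Set.Ioi v)).prod P), z.1 ∈ Set.Ioi v :=
      Measure.quasiMeasurePreserving_fst.ae (ae_restrict_mem measurableSet_Ioi)
    filter_upwards [hae] with z hz
    have hz' : 0 < z.1 := hv.trans hz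
    have h := (abs_remainderKernel_le m p (X z.2 * z.1)).trans
      (mul_le_mul_of_nonneg_left (minPow_le_pow m _) zero_le_two)
    rw [norm_mul, Real.norm_eq_abs, Real.norm_of_nonneg (by positivity : 0 ≤ z.1 ^ (-p - 1))]
    calc _ ≤ 2 * |X z.2 * z.1| ^ m * z.1 ^ (-p - 1) := by gcongr
      _ = _ := by
        rw [show (m : ℝ) - p - 1 = m + (-p - 1) by ring, Real.rpow_add hz', Real.rpow_natCast,
          abs_mul, abs_of_pos hz', mul_pow]
        ring

theorem kernelTail_mul_eq (m : ℕ) (p x : ℝ) {v : ℝ} (hv : 0 < v) :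
    ∫ t in Set.Ioi v, remainderKernel m p (x * t) * t ^ (-p - 1) =
      v ^ (-p) * kernelTail m p (v * x) := by
  have h := setIntegral_comp_mul_mul_rpow (fun u => remainderKernel m p (x * u)) p hv zero_le_one
  rw [mul_one] at h
  have h' : kernelTail m p (v * x) =
      ∫ t in Set.Ioi 1, remainderKernel m p (x * (v * t)) * t ^ (-p - 1) := by
    rw [kernelTail]
    simp only [mul_comm v x, mul_assoc]
  rw [h', h, ← mul_assoc, ← Real.rpow_add hv, neg_add_cancel, Real.rpow_zero, one_mul]

theorem integrableOn_momentIntegrand [SFinite P] (h1 : (ell p : ℝ) < p) (hX : AEMeasurable X P)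
    (hXm : Integrable (fun ω => |X ω| ^ ell p) P) {v : ℝ} (hv : 0 < v) :
    IntegrableOn (momentIntegrand P X p) (Set.Ioi v) := by
  refine (integrable_prod_remainderKernel h1 hX hXm hv).integral_prod_left.congr ?_
  filter_upwards [ae_restrict_mem measurableSet_Ioi] with t ht
  exact (momentIntegrand_eq hX hXm (hv.trans ht)).symm

theorem setIntegral_momentIntegrand [SFinite P] (h1 : (ell p : ℝ) < p) (hX : AEMeasurable X P)
    (hXm : Integrable (fun ω => |X ω| ^ ell p) P) {v : ℝ} (hv : 0 < v) :
    ∫ t in Set.Ioi v, momentIntegrand P X p t =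
      v ^ (-p) * ∫ ω, kernelTail (ell p) p (v * X ω) ∂P := by
  rw [setIntegral_congr_fun measurableSet_Ioi
      fun t ht => momentIntegrand_eq hX hXm (hv.trans (Set.mem_Ioi.mp ht)),
    integral_integral_swap (integrable_prod_remainderKernel h1 hX hXm hv), ← integral_const_mul]
  simp only [kernelTail_mul_eq _ _ _ hv]

/-- Pointwise, T(a) is asymptotic to π/Γ(p+1) · a^p at 0+; the bound D a^p gives a majorant free of
v. -/
theorem tendsto_rpow_neg_mul_integral_kernelTail (h1 : (m : ℝ) < p) (h2 : p < m + 1)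
    (hX : AEMeasurable X P) (hX0 : ∀ ω, 0 ≤ X ω) (hXp : Integrable (fun ω => X ω ^ p) P) :
    Tendsto (fun v => v ^ (-p) * ∫ ω, kernelTail m p (v * X ω) ∂P) (𝓝[>] 0)
      (𝓝 (Real.pi / Real.Gamma (p + 1) * ∫ ω, X ω ^ p ∂P)) := by
  have hp : 0 < p := (Nat.cast_nonneg m).trans_lt h1
  obtain ⟨D, -, hD⟩ := exists_abs_kernelTail_le_rpow h1 h2
  simp_rw [← integral_const_mul]
  refine tendsto_integral_filter_of_dominated_convergence (fun ω => D * X ω ^ p) ?_ ?_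
    (hXp.const_mul D) (ae_of_all _ fun ω => ?_)
  · exact Eventually.of_forall fun v => (((measurable_kernelTail m p).comp_aemeasurable
      (hX.const_mul v)).const_mul _).aestronglyMeasurable
  · filter_upwards [self_mem_nhdsWithin] with v hv
    have hv' : (0 : ℝ) < v := hv
    refine ae_of_all _ fun ω => ?_
    rw [norm_mul, Real.norm_of_nonneg (by positivity : 0 ≤ v ^ (-p)), Real.norm_eq_abs]
    calc _ ≤ v ^ (-p) * (D * (v * X ω) ^ p) := by
          gcongr; exact hD _ (mul_nonneg hv'.le (hX0 ω))
      _ = v ^ (-p) * v ^ p * (D * X ω ^ p) := by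
          rw [Real.mul_rpow hv'.le (hX0 ω)]; ring
      _ = _ := by rw [← Real.rpow_add hv', neg_add_cancel, Real.rpow_zero, one_mul]
  · rcases (hX0 ω).eq_or_lt with h | h
    · simp [← h, kernelTail_zero, Real.zero_rpow hp.ne']
    · have hlim : Tendsto (fun v : ℝ => v * X ω) (𝓝[>] 0) (𝓝[>] 0) := by
        refine tendsto_nhdsWithin_iff.mpr ⟨?_, ?_⟩
        · have : Tendsto (fun v : ℝ => v * X ω) (𝓝 0) (𝓝 (0 * X ω)) :=
            (continuous_mul_const (X ω)).tendsto 0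
          rw [zero_mul] at this
          exact this.mono_left nhdsWithin_le_nhds
        · filter_upwards [self_mem_nhdsWithin] with v hv
          exact mul_pos (Set.mem_Ioi.mp hv) h
      have := ((tendsto_rpow_neg_mul_kernelTail h1 h2).comp hlim).mul_const (X ω ^ p)
      refine this.congr' ?_
      filter_upwards [self_mem_nhdsWithin] with v hv
      have hv' : (0 : ℝ) < v := hv
      have e : (X ω) ^ (-p) * X ω ^ p = 1 := by
        rw [← Real.rpow_add h, neg_add_cancel, Real.rpow_zero]
      simp only [Function.comp]
      rw [Real.mul_rpow hv'.le h.le]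
      linear_combination (v ^ (-p) * kernelTail m p (v * X ω)) * e

theorem kernelTail_mul_eq_add (m : ℕ) (p v x : ℝ) :
    kernelTail m p (v * x) =
      kernelTail m p (v * max x 0) + kernelTail m p (-(v * max (-x) 0)) := by
  rcases le_total 0 x with h | h
  · simp [max_eq_left h, max_eq_right (neg_nonpos.mpr h), kernelTail_zero]
  · simp [max_eq_right h, max_eq_left (neg_nonneg.mpr h), kernelTail_zero]

end

/-! ### From the tail condition to a vanishing negative contribution. -/

/-- The ratio of `minPow m s` to s^(m+1) is min(1/s, 1), which decreases, so on (0, a) it is at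
least its value at a. The integral form is what the layer-cake formula accepts. -/
theorem minPow_le_mul_integral (m : ℕ) {a : ℝ} (ha : 0 ≤ a) :
    IntervalIntegrable (fun s => minPow m s / s) volume 0 a ∧
      minPow m a ≤ (m + 1) * ∫ s in (0 : ℝ)..a, minPow m s / s := by
  have hi : IntervalIntegrable (fun s => minPow m s / s) volume 0 a := by
    rw [intervalIntegrable_iff_integrableOn_Ioc_of_le ha]
    have hp : IntegrableOn (fun s : ℝ => s ^ m) (Set.Ioc 0 a) := by
      rw [← intervalIntegrable_iff_integrableOn_Ioc_of_le ha]
      exact (continuous_pow m).intervalIntegrable _ _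
    refine hp.mono' ((continuous_minPow m).measurable.div measurable_id).aestronglyMeasurable ?_
    filter_upwards [ae_restrict_mem measurableSet_Ioc] with s hs
    have hs' : (0 : ℝ) < s := hs.1
    rw [Real.norm_of_nonneg (div_nonneg (minPow_nonneg m hs'.le) hs'.le), div_le_iff₀ hs',
      ← pow_succ]
    exact minPow_le_pow_succ m s
  refine ⟨hi, ?_⟩
  rcases ha.eq_or_lt with rfl | ha'
  · simpa using minPow_le_pow_succ m 0
  have hle : ∫ s in (0 : ℝ)..a, minPow m a / a ^ (m + 1) * s ^ m ≤
      ∫ s in (0 : ℝ)..a, minPow m s / s := by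
    refine intervalIntegral.integral_mono_on_of_le_Ioo ha
      (((continuous_pow m).const_mul _).intervalIntegrable _ _) hi fun s hs => ?_
    have hs' : 0 < s := hs.1
    have hmin : min 1 a * s ≤ a * min 1 s := by
      have := hs.2
      rcases le_total 1 s with h | h
      · rw [min_eq_left h]; nlinarith [min_le_left 1 a]
      · rw [min_eq_right h]; nlinarith [min_le_right 1 a]
    rw [le_div_iff₀ hs', minPow_eq m ha, minPow_eq m hs'.le, pow_succ, div_mul_eq_mul_div,
      div_mul_eq_mul_div, div_le_iff₀ (by positivity)]
    calc _ = a ^ m * s ^ m * (min 1 a * s) := by ring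
      _ ≤ a ^ m * s ^ m * (a * min 1 s) := by gcongr
      _ = _ := by ring
  rw [intervalIntegral.integral_const_mul, integral_pow] at hle
  have hm : (0 : ℝ) < m + 1 := by positivity
  calc minPow m a = (m + 1) * (minPow m a / a ^ (m + 1) *
        ((a ^ (m + 1) - 0 ^ (m + 1)) / (m + 1))) := by
        rw [zero_pow (by simp), sub_zero]
        field_simp
    _ ≤ _ := by gcongr

section

variable {Ω : Type*} [MeasurableSpace Ω] {P : Measure Ω} [IsFiniteMeasure P]
  {m : ℕ} {p : ℝ} {Y : Ω → ℝ}

theorem measurable_rpow_mul_measureReal_lt (P : Measure Ω) [IsFiniteMeasure P] (Y : Ω → ℝ)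
    (p : ℝ) :
    Measurable (fun x : ℝ => x ^ p * P.real {ω | x < Y ω}) := by
  have h : Antitone (fun x : ℝ => P.real {ω | x < Y ω}) := fun x y hxy =>
    measureReal_mono fun ω (hω : y < Y ω) => hxy.trans_lt hω
  exact (measurable_id.pow_const p).mul h.measurable

theorem integrableOn_minPow_mul_tail (h1 : (m : ℝ) < p) (h2 : p < m + 1) {B : ℝ}
    (hB : ∀ x : ℝ, 0 < x → x ^ p * P.real {ω | x < Y ω} ≤ B) {v : ℝ} (hv : 0 < v) :
    IntegrableOn (fun s => minPow m s * s ^ (-p - 1) *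
      ((s / v) ^ p * P.real {ω | s / v < Y ω})) (Set.Ioi 0) := by
  refine ((integrableOn_minPow_mul_rpow h1 h2).mul_const B).mono' ?_ ?_
  · exact ((((continuous_minPow m).measurable.mul (measurable_id.pow_const _))).mul
      ((measurable_rpow_mul_measureReal_lt P Y p).comp
        (measurable_id.div_const v))).aestronglyMeasurable
  · filter_upwards [ae_restrict_mem measurableSet_Ioi] with s hs
    have hs' : (0 : ℝ) < s := hs
    have := minPow_nonneg m hs'.le
    rw [Real.norm_of_nonneg (by positivity)]
    gcongr
    exact hB _ (by positivity)

theorem integral_minPow_le (h1 : (m : ℝ) < p) (h2 : p < m + 1) (hY : AEMeasurable Y P)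
    (hY0 : ∀ ω, 0 ≤ Y ω) {B : ℝ}
    (hB : ∀ x : ℝ, 0 < x → x ^ p * P.real {ω | x < Y ω} ≤ B) {v : ℝ} (hv : 0 < v) :
    Integrable (fun ω => minPow m (v * Y ω)) P ∧
      v ^ (-p) * ∫ ω, minPow m (v * Y ω) ∂P ≤
        (m + 1) * ∫ s in Set.Ioi (0 : ℝ), minPow m s * s ^ (-p - 1) *
          ((s / v) ^ p * P.real {ω | s / v < Y ω}) := by
  set W := ∫ s in Set.Ioi (0 : ℝ), minPow m s * s ^ (-p - 1) *
    ((s / v) ^ p * P.real {ω | s / v < Y ω}) with hW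
  have hWi := integrableOn_minPow_mul_tail (Y := Y) (P := P) h1 h2 hB hv
  have hnn : ∀ ω, 0 ≤ v * Y ω := fun ω => mul_nonneg hv.le (hY0 ω)
  have hW0 : 0 ≤ W := setIntegral_nonneg measurableSet_Ioi fun s hs => by
    have hs' : (0 : ℝ) < s := hs
    have := minPow_nonneg m hs'.le
    positivity
  have hmeas : AEStronglyMeasurable (fun ω => minPow m (v * Y ω)) P :=
    ((continuous_minPow m).measurable.comp_aemeasurable (hY.const_mul v)).aestronglyMeasurable
  have h0 : 0 ≤ᵐ[P] fun ω => minPow m (v * Y ω) := ae_of_all _ fun ω => minPow_nonneg m (hnn ω)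
  have hm : (0 : ℝ) ≤ m + 1 := by positivity
  -- Working with lower integrals makes integrability part of the conclusion rather than a
  -- prerequisite.
  have key : ∫⁻ ω, ENNReal.ofReal (minPow m (v * Y ω)) ∂P ≤
      ENNReal.ofReal ((m + 1) * (v ^ p * W)) := by
    calc ∫⁻ ω, ENNReal.ofReal (minPow m (v * Y ω)) ∂P
        ≤ ∫⁻ ω, ENNReal.ofReal (m + 1) *
            ENNReal.ofReal (∫ s in (0 : ℝ)..(v * Y ω), minPow m s / s) ∂P := by
          refine lintegral_mono fun ω => ?_
          rw [← ENNReal.ofReal_mul hm]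
          exact ENNReal.ofReal_le_ofReal (minPow_le_mul_integral m (hnn ω)).2
      _ = ENNReal.ofReal (m + 1) * ∫⁻ s in Set.Ioi (0 : ℝ),
            P {ω | s < v * Y ω} * ENNReal.ofReal (minPow m s / s) := by
          rw [lintegral_const_mul' _ _ ENNReal.ofReal_ne_top,
            lintegral_comp_eq_lintegral_meas_lt_mul P (ae_of_all _ hnn) (hY.const_mul v)
              (fun t ht => (minPow_le_mul_integral m (Set.mem_Ioi.mp ht).le).1)]
          filter_upwards [ae_restrict_mem measurableSet_Ioi] with s hs
          exact div_nonneg (minPow_nonneg m (Set.mem_Ioi.mp hs).le) (Set.mem_Ioi.mp hs).le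
      _ = ENNReal.ofReal (m + 1) * ∫⁻ s in Set.Ioi (0 : ℝ),
            ENNReal.ofReal (v ^ p * (minPow m s * s ^ (-p - 1) *
              ((s / v) ^ p * P.real {ω | s / v < Y ω}))) := by
          congr 1
          refine setLIntegral_congr_fun measurableSet_Ioi fun s hs => ?_
          have hs' : (0 : ℝ) < s := hs
          have hset : {ω | s < v * Y ω} = {ω | s / v < Y ω} := by
            ext ω; simp only [Set.mem_ofPred_eq, div_lt_iff₀ hv, mul_comm v]
          have e : v ^ p * (s ^ (-p - 1) * (s / v) ^ p) = 1 / s := by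
            rw [Real.div_rpow hs'.le hv.le, show -p - 1 = -1 - p by ring, Real.rpow_sub hs',
              Real.rpow_neg_one]
            have := (Real.rpow_pos_of_pos hs' p).ne'
            have := (Real.rpow_pos_of_pos hv p).ne'
            field_simp
          rw [hset, ← ofReal_measureReal, ← ENNReal.ofReal_mul measureReal_nonneg]
          congr 1
          linear_combination (-(minPow m s * P.real {ω | s / v < Y ω})) * e
      _ = _ := by
          rw [← ofReal_integral_eq_lintegral_ofReal (hWi.const_mul _), integral_const_mul,
            ENNReal.ofReal_mul hm]
          filter_upwards [ae_restrict_mem measurableSet_Ioi] with s hs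
          have hs' : (0 : ℝ) < s := hs
          have := minPow_nonneg m hs'.le
          simp only [Pi.zero_apply]
          positivity
  refine ⟨(lintegral_ofReal_ne_top_iff_integrable hmeas h0).mp
    (ne_top_of_le_ne_top ENNReal.ofReal_ne_top key), ?_⟩
  have hle : ∫ ω, minPow m (v * Y ω) ∂P ≤ (m + 1) * (v ^ p * W) := by
    rw [integral_eq_lintegral_of_nonneg_ae h0 hmeas]
    exact ENNReal.toReal_le_of_le_ofReal (by positivity) key
  calc v ^ (-p) * ∫ ω, minPow m (v * Y ω) ∂P ≤ v ^ (-p) * ((m + 1) * (v ^ p * W)) := by gcongr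
    _ = (v ^ (-p) * v ^ p) * ((m + 1) * W) := by ring
    _ = _ := by rw [← Real.rpow_add hv, neg_add_cancel, Real.rpow_zero, one_mul]

theorem exists_rpow_mul_tail_le (hp : 0 < p)
    (h : Tendsto (fun x : ℝ => x ^ p * P.real {ω | x < Y ω}) atTop (𝓝 0)) :
    ∃ B : ℝ, ∀ x : ℝ, 0 < x → x ^ p * P.real {ω | x < Y ω} ≤ B := by
  obtain ⟨N, hN⟩ := eventually_atTop.mp (h.eventually (ge_mem_nhds zero_lt_one))
  -- The limit controls only x ≥ N; below N the total mass suffices.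
  refine ⟨max 1 (|N| ^ p * P.real Set.univ), fun x hx => ?_⟩
  rcases le_total N x with hx' | hx'
  · exact (hN x hx').trans (le_max_left _ _)
  · refine le_max_of_le_right ?_
    have h1 : P.real {ω | x < Y ω} ≤ P.real Set.univ := measureReal_mono (Set.subset_univ _)
    have h2 : x ≤ |N| := hx'.trans (le_abs_self _)
    gcongr

theorem tendsto_integral_minPow_mul_tail (h1 : (m : ℝ) < p) (h2 : p < m + 1) {B : ℝ}
    (hB : ∀ x : ℝ, 0 < x → x ^ p * P.real {ω | x < Y ω} ≤ B)
    (h : Tendsto (fun x : ℝ => x ^ p * P.real {ω | x < Y ω}) atTop (𝓝 0)) :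
    Tendsto (fun v : ℝ => ∫ s in Set.Ioi (0 : ℝ), minPow m s * s ^ (-p - 1) *
      ((s / v) ^ p * P.real {ω | s / v < Y ω})) (𝓝[>] 0) (𝓝 0) := by
  rw [show 𝓝 (0 : ℝ) = 𝓝 (∫ _ in Set.Ioi (0 : ℝ), (0 : ℝ)) by rw [integral_zero]]
  refine tendsto_integral_filter_of_dominated_convergence
    (fun s => minPow m s * s ^ (-p - 1) * B) ?_ ?_
    ((integrableOn_minPow_mul_rpow h1 h2).mul_const B) ?_
  · filter_upwards [self_mem_nhdsWithin] with v hv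
    exact (integrableOn_minPow_mul_tail (Y := Y) (P := P) h1 h2 hB
      (Set.mem_Ioi.mp hv)).aestronglyMeasurable
  · filter_upwards [self_mem_nhdsWithin] with v hv
    have hv' : (0 : ℝ) < v := hv
    filter_upwards [ae_restrict_mem measurableSet_Ioi] with s hs
    have hs' : (0 : ℝ) < s := hs
    have := minPow_nonneg m hs'.le
    rw [Real.norm_of_nonneg (by positivity)]
    gcongr
    exact hB _ (by positivity)
  · filter_upwards [ae_restrict_mem measurableSet_Ioi] with s hs
    have hs' : (0 : ℝ) < s := hs
    have hdiv : Tendsto (fun v : ℝ => s / v) (𝓝[>] 0) atTop := by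
      simp only [div_eq_mul_inv]
      exact tendsto_inv_nhdsGT_zero.const_mul_atTop hs'
    simpa using (h.comp hdiv).const_mul (minPow m s * s ^ (-p - 1))

theorem tendsto_rpow_neg_mul_integral_kernelTail_neg (h1 : (m : ℝ) < p) (h2 : p < m + 1)
    (hY : AEMeasurable Y P) (hY0 : ∀ ω, 0 ≤ Y ω)
    (h : Tendsto (fun x : ℝ => x ^ p * P.real {ω | x < Y ω}) atTop (𝓝 0)) :
    Integrable (fun ω => Y ω ^ m) P ∧
      Tendsto (fun v => v ^ (-p) * ∫ ω, kernelTail m p (-(v * Y ω)) ∂P) (𝓝[>] 0) (𝓝 0) := by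
  have hp : 0 < p := (Nat.cast_nonneg m).trans_lt h1
  obtain ⟨B, hB⟩ := exists_rpow_mul_tail_le hp h
  constructor
  · have hi := (integral_minPow_le h1 h2 hY hY0 hB one_pos).1
    -- For y ≥ 0, y^m ≤ 1 + `minPow m y`, so the m-th moment comes from the case v = 1.
    refine ((integrable_const (1 : ℝ)).add hi).mono' (hY.pow_const m).aestronglyMeasurable
      (ae_of_all _ fun ω => ?_)
    have h0 := hY0 ω
    rw [Real.norm_of_nonneg (by positivity)]
    simp only [one_mul, Pi.add_apply]
    rw [minPow_eq m h0]
    rcases le_total 1 (Y ω) with h' | h'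
    · rw [min_eq_left h']; linarith
    · linarith [pow_le_one₀ (n := m) h0 h', mul_nonneg (pow_nonneg h0 m) (le_min zero_le_one h0)]
  · obtain ⟨C, hC0, hC⟩ := exists_abs_kernelTail_neg_le_minPow h1 h2
    have hlim := (tendsto_integral_minPow_mul_tail h1 h2 hB h).const_mul (C * (m + 1))
    rw [mul_zero] at hlim
    refine squeeze_zero_norm' ?_ hlim
    filter_upwards [self_mem_nhdsWithin] with v hv
    have hv' : (0 : ℝ) < v := hv
    obtain ⟨hi, hle⟩ := integral_minPow_le h1 h2 hY hY0 hB hv'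
    have hb : ‖∫ ω, kernelTail m p (-(v * Y ω)) ∂P‖ ≤ C * ∫ ω, minPow m (v * Y ω) ∂P := by
      rw [← integral_const_mul]
      exact norm_integral_le_of_norm_le (hi.const_mul C)
        (ae_of_all _ fun ω => hC _ (mul_nonneg hv'.le (hY0 ω)))
    rw [norm_mul, Real.norm_of_nonneg (by positivity : 0 ≤ v ^ (-p)), mul_assoc]
    calc _ ≤ v ^ (-p) * (C * ∫ ω, minPow m (v * Y ω) ∂P) := by gcongr
      _ = C * (v ^ (-p) * ∫ ω, minPow m (v * Y ω) ∂P) := by ring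
      _ ≤ _ := by gcongr

end

/-! ### From a vanishing negative contribution back to the tail condition. -/

section

variable {Ω : Type*} [MeasurableSpace Ω] {P : Measure Ω}
  {m : ℕ} {p : ℝ} {Y : Ω → ℝ}

theorem integrable_prod_exp_neg_mul_kernelTail [SFinite P] (h1 : (m : ℝ) < p)
    (hY : AEMeasurable Y P) (hYm : Integrable (fun ω => |Y ω| ^ m) P) :
    Integrable (fun z : ℝ × Ω => Real.exp (-z.1) * kernelTail m p (z.1 * Y z.2))
      ((volume.restrict (Set.Ioi 0)).prod P) := by
  have hs := integrableOn_exp_neg_mul_pow m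
  refine (hs.mul_prod (hYm.const_mul (2 / (p - m)))).mono' (AEMeasurable.aestronglyMeasurable ?_) ?_
  · exact (by fun_prop : Measurable fun z : ℝ × Ω => Real.exp (-z.1)).aemeasurable.mul
      ((measurable_kernelTail m p).comp_aemeasurable
        (measurable_fst.aemeasurable.mul hY.comp_snd))
  · have hae : ∀ᵐ z ∂((volume.restrict (Set.Ioi (0 : ℝ))).prod P), z.1 ∈ Set.Ioi (0 : ℝ) :=
      Measure.quasiMeasurePreserving_fst.ae (ae_restrict_mem measurableSet_Ioi)
    filter_upwards [hae] with z hz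
    have hz' : 0 < z.1 := hz
    rw [norm_mul, Real.norm_of_nonneg (Real.exp_pos _).le, Real.norm_eq_abs]
    calc _ ≤ Real.exp (-z.1) * (2 / (p - m) * |z.1 * Y z.2| ^ m) := by
          gcongr; exact abs_kernelTail_le_pow h1 _
      _ = _ := by rw [abs_mul, abs_of_pos hz', mul_pow]; ring

theorem integral_averagedTail [SFinite P] (h1 : (m : ℝ) < p) (h2 : p < m + 1)
    (hY : AEMeasurable Y P) (hYm : Integrable (fun ω => |Y ω| ^ m) P) :
    Integrable (fun ω => averagedTail m p (Y ω)) P ∧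
      ∫ ω, averagedTail m p (Y ω) ∂P =
        ∫ s in Set.Ioi (0 : ℝ), Real.exp (-s) * ∫ ω, kernelTail m p (s * Y ω) ∂P := by
  have hi := integrable_prod_exp_neg_mul_kernelTail h1 hY hYm
  simp_rw [← integral_exp_neg_mul_kernelTail h1 h2, ← integral_const_mul]
  exact ⟨hi.integral_prod_right, (integral_integral_swap hi).symm⟩

/-- With K(v) = v^(-p) E T(-vY), the averaged quantity is the integral of e^(-s) s^p K(vs).
Dominated convergence needs K bounded on all of (0, ∞), not just near 0. -/
theorem tendsto_rpow_neg_mul_integral_averagedTail [SFinite P] (h1 : (m : ℝ) < p) (h2 : p < m + 1)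
    (hY : AEMeasurable Y P) (hYm : Integrable (fun ω => |Y ω| ^ m) P)
    (h : Tendsto (fun v => v ^ (-p) * ∫ ω, kernelTail m p (-(v * Y ω)) ∂P) (𝓝[>] 0) (𝓝 0)) :
    Tendsto (fun v => v ^ (-p) * ∫ ω, averagedTail m p (-(v * Y ω)) ∂P) (𝓝[>] 0) (𝓝 0) := by
  have hp : 0 < p := (Nat.cast_nonneg m).trans_lt h1
  set K : ℝ → ℝ := fun v => v ^ (-p) * ∫ ω, kernelTail m p (-(v * Y ω)) ∂P with hK
  have hneg : ∀ v : ℝ, AEMeasurable (fun ω => -(v * Y ω)) P := fun v => (hY.const_mul v).neg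
  have hnegm : ∀ v : ℝ, Integrable (fun ω => |-(v * Y ω)| ^ m) P := fun v => by
    simp_rw [abs_neg, abs_mul, mul_pow]
    exact hYm.const_mul _
  obtain ⟨B, hB⟩ : ∃ B : ℝ, ∀ v : ℝ, 0 < v → |K v| ≤ B := by
    have hev : ∀ᶠ v in 𝓝[>] (0 : ℝ), |K v| ≤ 1 := by
      have := h.abs
      rw [abs_zero] at this
      exact this.eventually (ge_mem_nhds zero_lt_one)
    obtain ⟨δ, hδ, hδ'⟩ := mem_nhdsGT_iff_exists_Ioo_subset.mp hev
    have hδ0 : (0 : ℝ) < δ := hδ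
    set E := 2 / (p - m) * ∫ ω, |Y ω| ^ m ∂P
    have hE : 0 ≤ E := mul_nonneg (div_nonneg zero_le_two (by linarith))
      (integral_nonneg fun ω => by positivity)
    -- Beyond δ the moment bound gives |K(v)| ≤ v^(m-p) E, which decreases because m < p.
    refine ⟨max 1 (δ ^ ((m : ℝ) - p) * E), fun v hv => ?_⟩
    rcases lt_or_ge v δ with hvδ | hvδ
    · exact le_max_of_le_left (hδ' ⟨hv, hvδ⟩)
    · refine le_max_of_le_right ?_
      have hb : ‖∫ ω, kernelTail m p (-(v * Y ω)) ∂P‖ ≤ v ^ m * E := by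
        refine (norm_integral_le_of_norm_le ((hnegm v).const_mul (2 / (p - m)))
          (ae_of_all _ fun ω => abs_kernelTail_le_pow h1 _)).trans_eq ?_
        simp_rw [abs_neg, abs_mul, mul_pow, abs_of_pos hv]
        rw [integral_const_mul, integral_const_mul]
        ring
      rw [hK, abs_mul, abs_of_nonneg (by positivity : 0 ≤ v ^ (-p))]
      calc _ ≤ v ^ (-p) * (v ^ m * E) := by gcongr; exact hb
        _ = v ^ ((m : ℝ) - p) * E := by
          rw [sub_eq_neg_add, Real.rpow_add hv, Real.rpow_natCast, mul_assoc]
        _ ≤ _ := by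
          gcongr ?_ * E
          exact Real.rpow_le_rpow_of_nonpos hδ0 hvδ (by linarith)
  have hrepr : ∀ v : ℝ, 0 < v → ∀ s ∈ Set.Ioi (0 : ℝ),
      v ^ (-p) * (Real.exp (-s) * ∫ ω, kernelTail m p (s * -(v * Y ω)) ∂P) =
        Real.exp (-s) * s ^ p * K (v * s) := by
    intro v hv s hs
    have hs' : (0 : ℝ) < s := hs
    have e : s ^ p * s ^ (-p) = 1 := by
      rw [← Real.rpow_add hs', add_neg_cancel, Real.rpow_zero]
    have harg : ∀ ω, s * -(v * Y ω) = -(v * s * Y ω) := fun ω => by ring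
    simp only [hK, harg]
    rw [Real.mul_rpow hv.le hs'.le]
    linear_combination (-(v ^ (-p) * Real.exp (-s) *
      ∫ ω, kernelTail m p (-(v * s * Y ω)) ∂P)) * e
  have hJ : ∀ v : ℝ, 0 < v → v ^ (-p) * ∫ ω, averagedTail m p (-(v * Y ω)) ∂P =
      ∫ s in Set.Ioi (0 : ℝ), Real.exp (-s) * s ^ p * K (v * s) := by
    intro v hv
    rw [(integral_averagedTail h1 h2 (hneg v) (hnegm v)).2, ← integral_const_mul]
    exact setIntegral_congr_fun measurableSet_Ioi (hrepr v hv)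
  have hG : IntegrableOn (fun s : ℝ => Real.exp (-s) * s ^ p) (Set.Ioi 0) := by
    simpa using Real.GammaIntegral_convergent (s := p + 1) (by linarith)
  have hlim : Tendsto (fun v => ∫ s in Set.Ioi (0 : ℝ), Real.exp (-s) * s ^ p * K (v * s))
      (𝓝[>] 0) (𝓝 0) := by
    rw [show 𝓝 (0 : ℝ) = 𝓝 (∫ _ in Set.Ioi (0 : ℝ), (0 : ℝ)) by rw [integral_zero]]
    refine tendsto_integral_filter_of_dominated_convergence
      (fun s => Real.exp (-s) * s ^ p * B) ?_ ?_ (hG.mul_const B) ?_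
    · filter_upwards [self_mem_nhdsWithin] with v hv
      have hv' : (0 : ℝ) < v := hv
      have hi := ((integrable_prod_exp_neg_mul_kernelTail h1 (hneg v)
        (hnegm v)).integral_prod_left.const_mul (v ^ (-p))).aestronglyMeasurable
      refine hi.congr ?_
      filter_upwards [ae_restrict_mem measurableSet_Ioi] with s hs
      rw [← hrepr v hv' s hs, integral_const_mul]
    · filter_upwards [self_mem_nhdsWithin] with v hv
      have hv' : (0 : ℝ) < v := hv
      filter_upwards [ae_restrict_mem measurableSet_Ioi] with s hs
      have hs' : (0 : ℝ) < s := hs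
      rw [norm_mul, Real.norm_of_nonneg (by positivity), Real.norm_eq_abs]
      gcongr
      exact hB _ (mul_pos hv' hs')
    · filter_upwards [ae_restrict_mem measurableSet_Ioi] with s hs
      have hs' : (0 : ℝ) < s := hs
      have hvs : Tendsto (fun v : ℝ => v * s) (𝓝[>] 0) (𝓝[>] 0) := by
        refine tendsto_nhdsWithin_iff.mpr ⟨?_, ?_⟩
        · have : Tendsto (fun v : ℝ => v * s) (𝓝 0) (𝓝 (0 * s)) :=
            (continuous_mul_const s).tendsto 0
          rw [zero_mul] at this
          exact this.mono_left nhdsWithin_le_nhds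
        · filter_upwards [self_mem_nhdsWithin] with v hv
          exact mul_pos (Set.mem_Ioi.mp hv) hs'
      simpa using (h.comp hvs).const_mul (Real.exp (-s) * s ^ p)
  refine hlim.congr' ?_
  filter_upwards [self_mem_nhdsWithin] with v hv
  exact (hJ v hv).symm

/-- Taking v = A/x, the event Y > x forces vY ≥ A, where the signed averaged tail is at least c; its
nonnegativity elsewhere permits Markov's inequality. -/
theorem tendsto_rpow_mul_tail [IsFiniteMeasure P] (h1 : (m : ℝ) < p) (h2 : p < m + 1)
    (hY : AEMeasurable Y P) (hY0 : ∀ ω, 0 ≤ Y ω) (hYm : Integrable (fun ω => |Y ω| ^ m) P)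
    (h : Tendsto (fun v => v ^ (-p) * ∫ ω, kernelTail m p (-(v * Y ω)) ∂P) (𝓝[>] 0) (𝓝 0)) :
    Tendsto (fun x : ℝ => x ^ p * P.real {ω | x < Y ω}) atTop (𝓝 0) := by
  obtain ⟨c, A, hc, hA, hcA⟩ := exists_le_averagedTail_neg h1 h2
  have hJ := tendsto_rpow_neg_mul_integral_averagedTail h1 h2 hY hYm h
  have hv : Tendsto (fun x : ℝ => A / x) atTop (𝓝[>] 0) :=
    tendsto_nhdsWithin_iff.mpr ⟨tendsto_const_nhds.div_atTop tendsto_id,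
      by filter_upwards [eventually_gt_atTop 0] with x hx using div_pos hA hx⟩
  -- The factor A^p turns (A/x)^(-p) into x^p, 1/c is Markov's constant, and (-1)^m fixes the sign.
  have hlim := (hJ.comp hv).const_mul (A ^ p / c * (-1) ^ m)
  rw [mul_zero] at hlim
  refine squeeze_zero' ?_ ?_ hlim
  · filter_upwards [eventually_gt_atTop 0] with x hx
    positivity
  · filter_upwards [eventually_gt_atTop 0] with x hx
    have hv0 : 0 < A / x := div_pos hA hx
    have hi := (integral_averagedTail h1 h2 (Y := fun ω => -(A / x * Y ω)) (P := P)
      (hY.const_mul _).neg (by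
        simp_rw [abs_neg, abs_mul, mul_pow]
        exact hYm.const_mul _)).1.const_mul ((-1) ^ m)
    have hmarkov := mul_meas_ge_le_integral_of_nonneg
      (ae_of_all _ fun ω => averagedTail_neg_nonneg h1 h2 (mul_nonneg hv0.le (hY0 ω))) hi c
    rw [integral_const_mul] at hmarkov
    have hsub : P.real {ω | x < Y ω} ≤
        P.real {ω | c ≤ (-1) ^ m * averagedTail m p (-(A / x * Y ω))} := by
      refine measureReal_mono fun ω (hω : x < Y ω) => hcA _ ?_
      rw [div_mul_eq_mul_div, le_div_iff₀ hx]
      gcongr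
    have hle : P.real {ω | x < Y ω} ≤
        ((-1) ^ m * ∫ ω, averagedTail m p (-(A / x * Y ω)) ∂P) / c := by
      rw [le_div_iff₀ hc, mul_comm]
      exact (mul_le_mul_of_nonneg_left hsub hc.le).trans hmarkov
    have e : A ^ p * (A / x) ^ (-p) = x ^ p := by
      rw [Real.rpow_neg hv0.le, Real.div_rpow hA.le hx.le, inv_div,
        mul_div_cancel₀ _ (Real.rpow_pos_of_pos hA p).ne']
    simp only [Function.comp]
    calc _ ≤ x ^ p * (((-1) ^ m * ∫ ω, averagedTail m p (-(A / x * Y ω)) ∂P) / c) := by gcongr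
      _ = _ := by rw [← e]; ring

end

/-! ### Assembly of the equivalence. -/

theorem theorem2 {Ω : Type*} [MeasurableSpace Ω] (P : Measure Ω) [IsProbabilityMeasure P]
    (X : Ω → ℝ) (hX : AEMeasurable X P)
    (p : ℝ) (hp : 0 < p) (hp_int : ∀ n : ℕ, p ≠ (n : ℝ))
    (hXp : Integrable (fun ω => (max (X ω) 0) ^ p) P) :
    (Integrable (fun ω => |X ω| ^ (ell p)) P ∧
      ∃ L : ℝ, HasImproperIntegralAtZero (momentIntegrand P X p) L ∧
        ∫ ω, (max (X ω) 0) ^ p ∂P = Real.Gamma (p + 1) / Real.pi * L) ↔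
    (fun x : ℝ => P.real {ω | x < max (-X ω) 0}) =o[atTop] (fun x : ℝ => 1 / x ^ p) := by
  have h1 := natCast_ell_lt hp
  have h2 := lt_natCast_ell_add_one hp_int
  have hG : 0 < Real.Gamma (p + 1) := Real.Gamma_pos_of_pos (by linarith)
  set m := ell p with hm
  set Y : Ω → ℝ := fun ω => max (-X ω) 0 with hYdef
  have hY : AEMeasurable Y P := hX.neg.max aemeasurable_const
  have hY0 : ∀ ω, 0 ≤ Y ω := fun ω => le_max_right _ _
  have hZ : AEMeasurable (fun ω => max (X ω) 0) P := hX.max aemeasurable_const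
  have hZ0 : ∀ ω, 0 ≤ max (X ω) 0 := fun ω => le_max_right _ _
  have hpos := tendsto_rpow_neg_mul_integral_kernelTail h1 h2 hZ hZ0 hXp
  have htail : (fun x : ℝ => P.real {ω | x < Y ω}) =o[atTop] (fun x : ℝ => 1 / x ^ p) ↔
      Tendsto (fun x : ℝ => x ^ p * P.real {ω | x < Y ω}) atTop (𝓝 0) := by
    rw [isLittleO_iff_tendsto']
    · simp only [div_div_eq_mul_div, div_one, mul_comm]
    · filter_upwards [eventually_gt_atTop 0] with x hx h0
      exact absurd h0 (by positivity)
  have hdecomp : Integrable (fun ω => |X ω| ^ m) P → ∀ v : ℝ, 0 < v →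
      ∫ t in Set.Ioi v, momentIntegrand P X p t =
        v ^ (-p) * ∫ ω, kernelTail m p (v * max (X ω) 0) ∂P +
          v ^ (-p) * ∫ ω, kernelTail m p (-(v * Y ω)) ∂P := by
    intro hXm v hv
    have hle : ∀ (Z : Ω → ℝ), AEMeasurable Z P → (∀ ω, |Z ω| ≤ |v * X ω|) →
        Integrable (fun ω => kernelTail m p (Z ω)) P := by
      intro Z hZm hZle
      refine integrable_kernelTail_comp h1 hZm ((hXm.const_mul (|v| ^ m)).mono'
        (hZm.abs.pow_const m).aestronglyMeasurable (ae_of_all _ fun ω => ?_))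
      rw [Real.norm_of_nonneg (by positivity), ← mul_pow, ← abs_mul]
      exact pow_le_pow_left₀ (abs_nonneg _) (hZle ω) m
    rw [setIntegral_momentIntegrand h1 hX hXm hv, ← mul_add, ← integral_add]
    · simp only [← hm, kernelTail_mul_eq_add m p v (X _), hYdef]
    · refine hle _ (hZ.const_mul v) fun ω => ?_
      rw [abs_mul, abs_mul, abs_of_nonneg (hZ0 ω)]
      gcongr
      exact max_le (le_abs_self _) (abs_nonneg _)
    · refine hle _ (hY.const_mul v).neg fun ω => ?_
      rw [abs_neg, abs_mul, abs_mul, abs_of_nonneg (hY0 ω)]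
      gcongr
      exact max_le (neg_le_abs _) (abs_nonneg _)
  have hYm_of : Integrable (fun ω => |X ω| ^ m) P → Integrable (fun ω => |Y ω| ^ m) P := by
    intro hXm
    refine hXm.mono' (hY.abs.pow_const m).aestronglyMeasurable (ae_of_all _ fun ω => ?_)
    rw [Real.norm_of_nonneg (by positivity), abs_of_nonneg (hY0 ω)]
    exact pow_le_pow_left₀ (hY0 ω) (max_le (neg_le_abs _) (abs_nonneg _)) m
  rw [htail]
  constructor
  · rintro ⟨hXm, L, ⟨-, hL⟩, hEq⟩
    -- The formula makes L the limit of the positive contribution alone, so subtracting leaves a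
    -- negative contribution tending to 0.
    have hL' : L = Real.pi / Real.Gamma (p + 1) * ∫ ω, max (X ω) 0 ^ p ∂P := by
      rw [hEq]
      field_simp
    refine tendsto_rpow_mul_tail h1 h2 hY hY0 (hYm_of hXm) ?_
    have hsub := hL.sub hpos
    rw [hL', sub_self] at hsub
    refine hsub.congr' ?_
    filter_upwards [self_mem_nhdsWithin] with v hv
    rw [hdecomp hXm v hv, add_sub_cancel_left]
  · intro h
    obtain ⟨hYm, hK⟩ := tendsto_rpow_neg_mul_integral_kernelTail_neg h1 h2 hY hY0 h
    have hXm : Integrable (fun ω => |X ω| ^ m) P := by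
      -- As m < p, |X|^m ≤ 1 + X_+^p + Y^m.
      refine (((integrable_const (1 : ℝ)).add hXp).add hYm).mono'
        (hX.abs.pow_const m).aestronglyMeasurable (ae_of_all _ fun ω => ?_)
      rw [Real.norm_of_nonneg (by positivity)]
      simp only [Pi.add_apply]
      have hZp : 0 ≤ max (X ω) 0 ^ p := Real.rpow_nonneg (hZ0 ω) p
      have hYp : 0 ≤ Y ω ^ m := pow_nonneg (hY0 ω) m
      rcases le_total 0 (X ω) with hx | hx
      · rw [abs_of_nonneg hx, max_eq_left hx] at *
        rcases le_total (X ω) 1 with hx1 | hx1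
        · linarith [pow_le_one₀ (n := m) hx hx1]
        · have := Real.rpow_le_rpow_of_exponent_le hx1 h1.le
          rw [Real.rpow_natCast] at this
          linarith
      · have : |X ω| = Y ω := by
          rw [abs_of_nonpos hx, hYdef]
          exact (max_eq_left (neg_nonneg.mpr hx)).symm
        rw [this]
        linarith
    refine ⟨hXm, Real.pi / Real.Gamma (p + 1) * ∫ ω, max (X ω) 0 ^ p ∂P,
      ⟨fun v hv => integrableOn_momentIntegrand h1 hX hXm hv, ?_⟩, ?_⟩
    · have hadd := hpos.add hK
      rw [add_zero] at hadd
      refine hadd.congr' ?_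
      filter_upwards [self_mem_nhdsWithin] with v hv
      exact (hdecomp hXm v hv).symm
    · field_simp
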